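/- **Setting.** On a probability space, let $(X_n)_{n\ge 1}$ be a first-order random coefficient bifurcating autoregressive process, i.e. for all $n\ge1$, $$X_{2n}=a_nX_n+\varepsilon_{2n},\qquad X_{2n+1}=b_nX_n+\varepsilon_{2n+1},$$ where $\mathbb E[X_1^{16}]<\infty$, the pairs $(a_n,b_n)_{n\ge1}$ are i.i.d., the pairs $(\varepsilon_{2n},\varepsilon_{2n+1})_{n\ge1}$ are i.i.d., these two sequences are independent of each other, and the ancestor $X_1$ is independent of the two sequences. Put $\mathbb G_n=\{2^n,\dots,2^{n+1}-1\}$, $\mathbb T_n=\bigcup_{j=0}^n\mathbb G_j$, $\mathcal F_n=\sigma(X_k,\ k\in\mathbb T_n)$, and assume that for all $n\ge0$ and $k\in\mathbb G_n$, a.s., $$\mathbb E[a_k|\mathcal F_n]=a,\quad \mathbb E[b_k|\mathcal F_n]=b,\quad \mathbb E[\varepsilon_{2k}|\mathcal F_n]=c,\quad \mathbb E[\varepsilon_{2k+1}|\mathcal F_n]=d .$$ **Hypotheses.** * (H.1) For all $n\ge1$, $\mathbb E[a_n^{16}]<1$ and $\mathbb E[b_n^{16}]<1$; $\sup_{n\ge1}\mathbb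 E[\varepsilon_{2n}^{16}]<\infty$ and $\sup_{n\ge1}\mathbb E[\varepsilon_{2n+1}^{16}]<\infty$. * (H.2) For all $n\ge0$, $k\in\mathbb G_n$, a.s., $\mathrm{Var}[a_k|\mathcal F_n]=\sigma_a^2\ge0$, $\mathrm{Var}[b_k|\mathcal F_n]=\sigma_b^2\ge0$, $\mathrm{Var}[\varepsilon_{2k}|\mathcal F_n]=\sigma_c^2>0$, $\mathrm{Var}[\varepsilon_{2k+1}|\mathcal F_n]=\sigma_d^2>0$. * (H.3) There are constants $\rho_{ab}^2\le\sigma_a^2\sigma_b^2$ and $\rho_{cd}^2<\sigma_c^2\sigma_d^2$ such that for all $n\ge0$, $k\in\mathbb G_n$, a.s., $\mathbb E[(a_k-a)(b_k-b)|\mathcal F_n]=\rho_{ab}$ and $\mathbb E[(\varepsilon_{2k}-c)(\varepsilon_{2k+1}-d)|\mathcal F_n]=\rho_{cd}$. Moreover, for all $k\ne l$ in $\mathbb G_n$, $(\varepsilon_{2k},\varepsilon_{2k+1})$ and $(\varepsilon_{2l},\varepsilon_{2l+1})$ are conditionally independent given $\mathcal F_n$, and so are $(a_k,b_k)$ and $(a_l,b_l)$.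 **Notation.** For $k\in\mathbb G_n$ let $V_{2k}=X_{2k}-\mathbb E[X_{2k}|\mathcal F_n]$ and $V_{2k+1}=X_{2k+1}-\mathbb E[X_{2k+1}|\mathcal F_n]$. Let $M_0=0$ and, for $n\ge1$, $$M_n=\sum_{k\in\mathbb T_{n-1}}\begin{pmatrix}X_kV_{2k}\\V_{2k}\\X_kV_{2k+1}\\V_{2k+1}\end{pmatrix},\qquad \langle M\rangle_n=\sum_{k=0}^{n-1}\mathbb E\big[(M_{k+1}-M_k)(M_{k+1}-M_k)^t\,\big|\,\mathcal F_k\big].$$ With $A_p=\mathbb E[a_1^p]$, $B_p=\mathbb E[b_1^p]$, $C_p=\mathbb E[\varepsilon_2^p]$, $D_p=\mathbb E[\varepsilon_3^p]$, define $s_1,s_2,s_3,s_4$ recursively by $$s_p=\frac{2}{2-(A_p+B_p)}\left(\sum_{k=1}^{p-1}\frac12\binom pk\,(A_kC_{p-k}+B_kD_{p-k})\,s_k+\frac{C_p+D_p}{2}\right),$$ and put $$C=\begin{pmatrix}s_2&s_1\\s_1&1\end{pmatrix},\quad D=\begin{pmatrix}s_4&s_3\\s_3&s_2\end{pmatrix},\quad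 L=\begin{pmatrix}\sigma_c^2&\rho_{cd}\\\rho_{cd}&\sigma_d^2\end{pmatrix}\otimes C+\begin{pmatrix}\sigma_a^2&\rho_{ab}\\\rho_{ab}&\sigma_b^2\end{pmatrix}\otimes D .$$ **Proposition.** Under these assumptions and (H.1)–(H.3), $(M_n)$ is a square integrable martingale with respect to $(\mathcal F_n)$, its increasing process satisfies $$\lim_{n\to\infty}\frac{\langle M\rangle_n}{|\mathbb T_{n-1}|}=L\quad\text{a.s.},$$ and the matrix $L$ is positive definite. -/

import Mathlib

open MeasureTheory ProbabilityTheory Filter Topology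
open scoped Kronecker

namespace RCBAR

/-- The `n`-th generation `{2 ^ n, …, 2 ^ (n + 1) - 1}` of the binary tree. -/
def gen (n : ℕ) : Finset ℕ := Finset.Ico (2 ^ n) (2 ^ (n + 1))

/-- All the individuals up to the `n`-th generation. -/
def tree (n : ℕ) : Finset ℕ := (Finset.range (n + 1)).biUnion gen

/-- The σ-algebra generated by the `X k`, `k` running over the tree up to generation `n`. -/
abbrev genSigma {Ω : Type*} (X : ℕ → Ω → ℝ) (n : ℕ) : MeasurableSpace Ω :=
  ⨆ k ∈ tree n, MeasurableSpace.comap (X k) inferInstance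

theorem genSigma_mono {Ω : Type*} (X : ℕ → Ω → ℝ) : Monotone (genSigma X) := by
  intro m n hmn
  refine biSup_mono fun k hk => ?_
  simp only [tree, Finset.mem_biUnion, Finset.mem_range] at hk ⊢
  obtain ⟨i, hi, hik⟩ := hk
  exact ⟨i, by omega, hik⟩

theorem one_le_of_mem_tree {k n : ℕ} (hk : k ∈ tree n) : 1 ≤ k := by
  simp only [tree, Finset.mem_biUnion, gen, Finset.mem_Ico] at hk
  obtain ⟨i, -, hi, -⟩ := hk
  exact le_trans Nat.one_le_two_pow hi

section Model

variable {Ω : Type*} [mΩ : MeasurableSpace Ω]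

/-- The natural filtration associated with the generations. -/
def genFiltration (X : ℕ → Ω → ℝ) (hX : ∀ k, 1 ≤ k → Measurable (X k)) : Filtration ℕ mΩ where
  seq := genSigma X
  mono' := genSigma_mono X
  le' := fun _ => iSup₂_le fun k hk => (hX k (one_le_of_mem_tree hk)).comap_le

/-- Conditional independence of two random variables given a σ-algebra `m`. -/
def CondIndepGiven {E : Type*} [MeasurableSpace E] (μ : Measure Ω) (m : MeasurableSpace Ω)
    (f g : Ω → E) : Prop :=
  ∀ s t : Set E, MeasurableSet s → MeasurableSet t →
    μ[(f ⁻¹' s ∩ g ⁻¹' t).indicator (fun _ => (1 : ℝ)) | m] =ᵐ[μ]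
      μ[(f ⁻¹' s).indicator (fun _ => (1 : ℝ)) | m] *
        μ[(g ⁻¹' t).indicator (fun _ => (1 : ℝ)) | m]

/-- The standing assumptions on a first-order random coefficient bifurcating autoregressive process
`X` (indexed by `k ≥ 1`) with inherited effects `(aₙ n, bₙ n)` and environmental effects
`(ε (2 * n), ε (2 * n + 1))`, `n ≥ 1`; values at the remaining indices play no role. -/
structure IsRCBAR (μ : Measure Ω) (aₙ bₙ ε X : ℕ → Ω → ℝ) (a b c d : ℝ) : Prop where
  measurable_a : ∀ n, 1 ≤ n → Measurable (aₙ n)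
  measurable_b : ∀ n, 1 ≤ n → Measurable (bₙ n)
  measurable_ε : ∀ n, 2 ≤ n → Measurable (ε n)
  measurable_X : ∀ n, 1 ≤ n → Measurable (X n)
  /-- the autoregressive recursion -/
  even_eq : ∀ n, 1 ≤ n → ∀ ω, X (2 * n) ω = aₙ n ω * X n ω + ε (2 * n) ω
  odd_eq : ∀ n, 1 ≤ n → ∀ ω, X (2 * n + 1) ω = bₙ n ω * X n ω + ε (2 * n + 1) ω
  /-- the ancestor has a finite moment of order 16 -/
  integrable_X_one : Integrable (fun ω => X 1 ω ^ 16) μ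
  /-- `(aₙ n, bₙ n)`, `n ≥ 1`, are independent and identically distributed -/
  indep_ab : iIndepFun (fun (n : ℕ) ω => (aₙ (n + 1) ω, bₙ (n + 1) ω)) μ
  ident_ab : ∀ n, 1 ≤ n →
    IdentDistrib (fun ω => (aₙ n ω, bₙ n ω)) (fun ω => (aₙ 1 ω, bₙ 1 ω)) μ μ
  /-- `(ε (2 * n), ε (2 * n + 1))`, `n ≥ 1`, are independent and identically distributed -/
  indep_ε : iIndepFun (fun (n : ℕ) ω => (ε (2 * (n + 1)) ω, ε (2 * (n + 1) + 1) ω)) μ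
  ident_ε : ∀ n, 1 ≤ n →
    IdentDistrib (fun ω => (ε (2 * n) ω, ε (2 * n + 1) ω)) (fun ω => (ε 2 ω, ε 3 ω)) μ μ
  /-- the two sequences are independent of each other -/
  indep_ab_ε : IndepFun (fun ω (n : ℕ) => (aₙ (n + 1) ω, bₙ (n + 1) ω))
    (fun ω (n : ℕ) => (ε (2 * (n + 1)) ω, ε (2 * (n + 1) + 1) ω)) μ
  /-- the ancestor is independent of the two sequences -/
  indep_X_one : IndepFun (X 1)
    (fun ω => (fun n : ℕ => (aₙ (n + 1) ω, bₙ (n + 1) ω),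
      fun n : ℕ => (ε (2 * (n + 1)) ω, ε (2 * (n + 1) + 1) ω))) μ
  /-- the conditional means -/
  condExp_a : ∀ n, ∀ k ∈ gen n, μ[aₙ k | genSigma X n] =ᵐ[μ] fun _ => a
  condExp_b : ∀ n, ∀ k ∈ gen n, μ[bₙ k | genSigma X n] =ᵐ[μ] fun _ => b
  condExp_ε_even : ∀ n, ∀ k ∈ gen n, μ[ε (2 * k) | genSigma X n] =ᵐ[μ] fun _ => c
  condExp_ε_odd : ∀ n, ∀ k ∈ gen n, μ[ε (2 * k + 1) | genSigma X n] =ᵐ[μ] fun _ => d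

/-- Moments of order 16. -/
structure H1 (μ : Measure Ω) (aₙ bₙ ε : ℕ → Ω → ℝ) : Prop where
  integrable_a : ∀ n, 1 ≤ n → Integrable (fun ω => aₙ n ω ^ 16) μ
  integrable_b : ∀ n, 1 ≤ n → Integrable (fun ω => bₙ n ω ^ 16) μ
  moment_a : ∀ n, 1 ≤ n → ∫ ω, aₙ n ω ^ 16 ∂μ < 1
  moment_b : ∀ n, 1 ≤ n → ∫ ω, bₙ n ω ^ 16 ∂μ < 1
  moment_ε_even : ∃ K : ℝ, ∀ n, 1 ≤ n →
    Integrable (fun ω => ε (2 * n) ω ^ 16) μ ∧ ∫ ω, ε (2 * n) ω ^ 16 ∂μ ≤ K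
  moment_ε_odd : ∃ K : ℝ, ∀ n, 1 ≤ n →
    Integrable (fun ω => ε (2 * n + 1) ω ^ 16) μ ∧ ∫ ω, ε (2 * n + 1) ω ^ 16 ∂μ ≤ K

/-- Conditional variances. -/
structure H2 (μ : Measure Ω) (aₙ bₙ ε X : ℕ → Ω → ℝ) (σa σb σc σd : ℝ) : Prop where
  var_a : ∀ n, ∀ k ∈ gen n, condVar (genSigma X n) (aₙ k) μ =ᵐ[μ] fun _ => σa ^ 2
  var_b : ∀ n, ∀ k ∈ gen n, condVar (genSigma X n) (bₙ k) μ =ᵐ[μ] fun _ => σb ^ 2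
  var_ε_even : ∀ n, ∀ k ∈ gen n,
    condVar (genSigma X n) (ε (2 * k)) μ =ᵐ[μ] fun _ => σc ^ 2
  var_ε_odd : ∀ n, ∀ k ∈ gen n,
    condVar (genSigma X n) (ε (2 * k + 1)) μ =ᵐ[μ] fun _ => σd ^ 2
  pos_c : 0 < σc ^ 2
  pos_d : 0 < σd ^ 2

/-- Conditional covariances and conditional independence. -/
structure H3 (μ : Measure Ω) (aₙ bₙ ε X : ℕ → Ω → ℝ) (a b c d σa σb σc σd ρab ρcd : ℝ) :
    Prop where
  le_ab : ρab ^ 2 ≤ σa ^ 2 * σb ^ 2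
  lt_cd : ρcd ^ 2 < σc ^ 2 * σd ^ 2
  cov_ab : ∀ n, ∀ k ∈ gen n,
    μ[fun ω => (aₙ k ω - a) * (bₙ k ω - b) | genSigma X n] =ᵐ[μ] fun _ => ρab
  cov_ε : ∀ n, ∀ k ∈ gen n,
    μ[fun ω => (ε (2 * k) ω - c) * (ε (2 * k + 1) ω - d) | genSigma X n] =ᵐ[μ] fun _ => ρcd
  condIndep_ε : ∀ n, ∀ k ∈ gen n, ∀ l ∈ gen n, k ≠ l →
    CondIndepGiven μ (genSigma X n) (fun ω => (ε (2 * k) ω, ε (2 * k + 1) ω))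
      (fun ω => (ε (2 * l) ω, ε (2 * l + 1) ω))
  condIndep_ab : ∀ n, ∀ k ∈ gen n, ∀ l ∈ gen n, k ≠ l →
    CondIndepGiven μ (genSigma X n) (fun ω => (aₙ k ω, bₙ k ω)) (fun ω => (aₙ l ω, bₙ l ω))

/-- The noise `V m = X m - E[X m | ℱ]` for `m ≥ 2`, where `ℱ` is the σ-algebra of all individuals
up to the generation that precedes the generation `Nat.log 2 m` of `m`. -/
noncomputable def V (μ : Measure Ω) (X : ℕ → Ω → ℝ) (m : ℕ) (ω : Ω) : ℝ :=
  X m ω - (μ[X m | genSigma X (Nat.log 2 m - 1)]) ω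

/-- The martingale `M n`, the sum over the individuals `k` of the generations `0, …, n - 1` of the
vectors `(X k * V (2k), V (2k), X k * V (2k+1), V (2k+1))`. The coordinates are indexed by
`Fin 2 × Fin 2` in lexicographic order: the first index chooses between `V (2k)` and `V (2k+1)`,
the second one between `X k` and `1`. -/
noncomputable def M (μ : Measure Ω) (X : ℕ → Ω → ℝ) (n : ℕ) (ω : Ω) : Fin 2 × Fin 2 → ℝ :=
  fun i => ∑ j ∈ Finset.range n, ∑ k ∈ gen j, ![X k ω, 1] i.2 * V μ X (2 * k + i.1) ω

/-- The increasing process (predictable matrix-valued quadratic variation)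
`∑_{k < n} E[ΔN_{k+1} ΔN_{k+1}ᵗ | ℱ k]` of a vector-valued process `N`. -/
noncomputable def increasingProcess {ι : Type*} (μ : Measure Ω) (ℱ : ℕ → MeasurableSpace Ω)
    (N : ℕ → Ω → ι → ℝ) (n : ℕ) (ω : Ω) : Matrix ι ι ℝ :=
  Matrix.of fun i j => ∑ k ∈ Finset.range n,
    (μ[fun ω' => (N (k + 1) ω' i - N k ω' i) * (N (k + 1) ω' j - N k ω' j) | ℱ k]) ω

/-- The constants `s p`, given by the recursion
`s p = 2 / (2 - (A p + B p)) * (∑_{k=1}^{p-1} (1/2) (p choose k) (A k * C (p-k) + B k * D (p-k)) s k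
  + (C p + D p) / 2)` for `p ≥ 1`, where `A p = E[a₁ ^ p]`, `B p = E[b₁ ^ p]`, `C p = E[ε₂ ^ p]`,
`D p = E[ε₃ ^ p]`. -/
noncomputable def s (μ : Measure Ω) (aₙ bₙ ε : ℕ → Ω → ℝ) (p : ℕ) : ℝ :=
  2 / (2 - ((∫ ω, aₙ 1 ω ^ p ∂μ) + ∫ ω, bₙ 1 ω ^ p ∂μ)) *
    ((∑ k : Fin p, if k.1 = 0 then 0 else
        1 / 2 * (p.choose k.1 : ℝ) *
          ((∫ ω, aₙ 1 ω ^ k.1 ∂μ) * (∫ ω, ε 2 ω ^ (p - k.1) ∂μ) +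
            (∫ ω, bₙ 1 ω ^ k.1 ∂μ) * (∫ ω, ε 3 ω ^ (p - k.1) ∂μ)) * s μ aₙ bₙ ε k.1) +
      ((∫ ω, ε 2 ω ^ p ∂μ) + ∫ ω, ε 3 ω ^ p ∂μ) / 2)
termination_by p
decreasing_by exact k.2

/-- The matrix `C`. -/
noncomputable def C (μ : Measure Ω) (aₙ bₙ ε : ℕ → Ω → ℝ) : Matrix (Fin 2) (Fin 2) ℝ :=
  !![s μ aₙ bₙ ε 2, s μ aₙ bₙ ε 1; s μ aₙ bₙ ε 1, 1]

/-- The matrix `D`. -/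
noncomputable def D (μ : Measure Ω) (aₙ bₙ ε : ℕ → Ω → ℝ) : Matrix (Fin 2) (Fin 2) ℝ :=
  !![s μ aₙ bₙ ε 4, s μ aₙ bₙ ε 3; s μ aₙ bₙ ε 3, s μ aₙ bₙ ε 2]

/-- The limit matrix `L`. -/
noncomputable def L (μ : Measure Ω) (aₙ bₙ ε : ℕ → Ω → ℝ) (σa σb σc σd ρab ρcd : ℝ) :
    Matrix (Fin 2 × Fin 2) (Fin 2 × Fin 2) ℝ :=
  !![σc ^ 2, ρcd; ρcd, σd ^ 2] ⊗ₖ C μ aₙ bₙ ε + !![σa ^ 2, ρab; ρab, σb ^ 2] ⊗ₖ D μ aₙ bₙ ε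

end Model

end RCBAR

namespace RCBAR

/-! ### Regrouping independent σ-algebras. -/

section Independence

/-! The engine is one independence statement, `indep_othersSigma`: the effects on the daughters of
`k` are independent of the σ-algebra `othersSigma k` generated by the ancestor and all the other
effects. Since `X l` with `l < 2k` never involves the effects on the daughters of `k`, this
σ-algebra contains `X k`, everything attached to smaller mothers, and the generation σ-algebra of
`k`. Conditional expectations are therefore computed given `othersSigma k`, by replacing functions
of the effects by their means, and then passed down to the generation by the tower property.

The convergence is a law of large numbers for powers. Sixteenth moments stay bounded along the tree
by a contraction argument (`exists_moment_sixteen_bound`). For `p ≤ 8` the sum of the `p`-th powers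
of the daughters of `k`, minus its conditional mean, is square integrable, and these fluctuations
are pairwise orthogonal. Their average over generation `n` thus has second moment `O(2⁻ⁿ)` and
vanishes almost surely. What remains is an affine recursion for the generation average of `X ^ p`,
with ratio `(A_p + B_p) / 2` of modulus below 1 and forcing by lower powers. Induction on `p` gives
the limit `s p` (`ae_tendsto_gen_average`), which carries over to tree averages.

The martingale increments are sums of orthogonal innovations whose conditional covariances are
explicit polynomials in `X k` (`condExp_innov_mul_self`). The increasing process is thus a
combination of tree sums of powers of order at most 4, and the limit is read off entrywise.

For definiteness, `C` is positive definite by a variance decomposition that contains `σc² + σd² >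
0`, `D` is positive semidefinite as a limit of empirical Gram matrices, and Kronecker products
preserve both properties. -/

theorem generateFrom_inter_eq_sup {Ω : Type*} (m₁ m₂ : MeasurableSpace Ω) :
    MeasurableSpace.generateFrom
      {u | ∃ s t, MeasurableSet[m₁] s ∧ MeasurableSet[m₂] t ∧ u = s ∩ t} = m₁ ⊔ m₂ := by
  apply le_antisymm
  · refine MeasurableSpace.generateFrom_le ?_
    rintro _ ⟨s, t, hs, ht, rfl⟩
    have hs' : MeasurableSet[m₁ ⊔ m₂] s := (le_sup_left : m₁ ≤ m₁ ⊔ m₂) s hs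
    have ht' : MeasurableSet[m₁ ⊔ m₂] t := (le_sup_right : m₂ ≤ m₁ ⊔ m₂) t ht
    exact MeasurableSet.inter hs' ht'
  · refine sup_le (fun s hs => ?_) (fun t ht => ?_)
    · exact MeasurableSpace.measurableSet_generateFrom
        ⟨s, Set.univ, hs, MeasurableSet.univ, by simp⟩
    · exact MeasurableSpace.measurableSet_generateFrom
        ⟨Set.univ, t, MeasurableSet.univ, ht, by simp⟩

theorem isPiSystem_inter {Ω : Type*} (m₁ m₂ : MeasurableSpace Ω) :
    IsPiSystem {u | ∃ s t, MeasurableSet[m₁] s ∧ MeasurableSet[m₂] t ∧ u = s ∩ t} := by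
  rintro _ ⟨s, t, hs, ht, rfl⟩ _ ⟨s', t', hs', ht', rfl⟩ -
  exact ⟨s ∩ s', t ∩ t', hs.inter hs', ht.inter ht', by
    ext; simp only [Set.mem_inter_iff]; tauto⟩

/-- Two independent pairs of independent σ-algebras can be regrouped. -/
theorem indep_sup_sup {Ω : Type*} {mΩ : MeasurableSpace Ω} {μ : Measure Ω} [IsProbabilityMeasure μ]
    {m₁ m₂ n₁ n₂ : MeasurableSpace Ω} (hm₁ : m₁ ≤ mΩ) (hm₂ : m₂ ≤ mΩ) (hn₁ : n₁ ≤ mΩ)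
    (hn₂ : n₂ ≤ mΩ) (h : Indep (m₁ ⊔ m₂) (n₁ ⊔ n₂) μ) (hm : Indep m₁ m₂ μ) (hn : Indep n₁ n₂ μ) :
    Indep (m₁ ⊔ n₁) (m₂ ⊔ n₂) μ := by
  refine IndepSets.indep (sup_le hm₁ hn₁) (sup_le hm₂ hn₂) (isPiSystem_inter m₁ n₁)
    (isPiSystem_inter m₂ n₂) (generateFrom_inter_eq_sup _ _).symm
    (generateFrom_inter_eq_sup _ _).symm ?_
  rw [IndepSets_iff]
  rintro _ _ ⟨s, t, hs, ht, rfl⟩ ⟨s', t', hs', ht', rfl⟩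
  rw [Indep_iff] at h hm hn
  have e₁ : MeasurableSet[m₁ ⊔ m₂] s := (le_sup_left : m₁ ≤ m₁ ⊔ m₂) s hs
  have e₂ : MeasurableSet[m₁ ⊔ m₂] s' := (le_sup_right : m₂ ≤ m₁ ⊔ m₂) s' hs'
  have e₃ : MeasurableSet[n₁ ⊔ n₂] t := (le_sup_left : n₁ ≤ n₁ ⊔ n₂) t ht
  have e₄ : MeasurableSet[n₁ ⊔ n₂] t' := (le_sup_right : n₂ ≤ n₁ ⊔ n₂) t' ht'
  have e : s ∩ t ∩ (s' ∩ t') = (s ∩ s') ∩ (t ∩ t') := by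
    ext; simp only [Set.mem_inter_iff]; tauto
  -- Both sides become the product of the four probabilities of `s`, `s'`, `t`, `t'`.
  rw [e, h _ _ (MeasurableSet.inter e₁ e₂) (MeasurableSet.inter e₃ e₄), hm _ _ hs hs',
    hn _ _ ht ht', h _ _ e₁ e₃, h _ _ e₂ e₄]
  ring

end Independence

/-! ### Independence structure of the tree. -/

section Model

variable {Ω : Type*} {aₙ bₙ ε X : ℕ → Ω → ℝ}

/-- The random coefficient of the `i`-th daughter of `k`. -/
def coef (aₙ bₙ : ℕ → Ω → ℝ) (i : Fin 2) (k : ℕ) (ω : Ω) : ℝ := ![aₙ k ω, bₙ k ω] i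

/-- The σ-algebra of the random coefficients of the daughters of `k`. -/
abbrev coefSigma (aₙ bₙ : ℕ → Ω → ℝ) (k : ℕ) : MeasurableSpace Ω :=
  MeasurableSpace.comap (fun ω => (aₙ k ω, bₙ k ω)) inferInstance

/-- The σ-algebra of the environmental effects on the daughters of `k`. -/
abbrev noiseSigma (ε : ℕ → Ω → ℝ) (k : ℕ) : MeasurableSpace Ω :=
  MeasurableSpace.comap (fun ω => (ε (2 * k) ω, ε (2 * k + 1) ω)) inferInstance

/-- The σ-algebra of the ancestor and of all the effects except those on the daughters of `k`. -/
abbrev othersSigma (aₙ bₙ ε X : ℕ → Ω → ℝ) (k : ℕ) : MeasurableSpace Ω :=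
  MeasurableSpace.comap (X 1) inferInstance ⊔
    ((⨆ j ∈ {j : ℕ | j + 1 ≠ k}, coefSigma aₙ bₙ (j + 1)) ⊔
      ⨆ j ∈ {j : ℕ | j + 1 ≠ k}, noiseSigma ε (j + 1))

theorem measurable_coef_coefSigma (i : Fin 2) (k : ℕ) :
    Measurable[coefSigma aₙ bₙ k] (coef aₙ bₙ i k) := by
  have h := comap_measurable (m := (inferInstance : MeasurableSpace (ℝ × ℝ)))
    (fun ω => (aₙ k ω, bₙ k ω))
  fin_cases i
  · exact measurable_fst.comp h
  · exact measurable_snd.comp h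

theorem measurable_noise_noiseSigma (i : Fin 2) (k : ℕ) :
    Measurable[noiseSigma ε k] (ε (2 * k + i)) := by
  have h := comap_measurable (m := (inferInstance : MeasurableSpace (ℝ × ℝ)))
    (fun ω => (ε (2 * k) ω, ε (2 * k + 1) ω))
  fin_cases i
  · exact measurable_fst.comp h
  · exact measurable_snd.comp h

theorem coefSigma_le_othersSigma {k l : ℕ} (hl : 1 ≤ l) (hkl : l ≠ k) :
    coefSigma aₙ bₙ l ≤ othersSigma aₙ bₙ ε X k := by
  obtain ⟨j, rfl⟩ : ∃ j, l = j + 1 := ⟨l - 1, by omega⟩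
  have h : j ∈ {j : ℕ | j + 1 ≠ k} := hkl
  exact le_sup_of_le_right (le_sup_of_le_left
    (le_biSup (f := fun j => coefSigma aₙ bₙ (j + 1)) h))

theorem noiseSigma_le_othersSigma {k l : ℕ} (hl : 1 ≤ l) (hkl : l ≠ k) :
    noiseSigma ε l ≤ othersSigma aₙ bₙ ε X k := by
  obtain ⟨j, rfl⟩ : ∃ j, l = j + 1 := ⟨l - 1, by omega⟩
  have h : j ∈ {j : ℕ | j + 1 ≠ k} := hkl
  exact le_sup_of_le_right (le_sup_of_le_right
    (le_biSup (f := fun j => noiseSigma ε (j + 1)) h))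

theorem comap_comp_le {α β γ : Type*} {mβ : MeasurableSpace β} {mγ : MeasurableSpace γ}
    {g : β → γ} (hg : Measurable g) (f : α → β) :
    MeasurableSpace.comap (fun x => g (f x)) mγ ≤ MeasurableSpace.comap f mβ :=
  (hg.comp (comap_measurable f)).comap_le

theorem iSup_coefSigma_le_comap (s : Set ℕ) :
    ⨆ j ∈ s, coefSigma aₙ bₙ (j + 1) ≤
      MeasurableSpace.comap (fun ω (n : ℕ) => (aₙ (n + 1) ω, bₙ (n + 1) ω)) inferInstance :=
  iSup₂_le fun j _ => comap_comp_le (measurable_pi_apply (X := fun _ : ℕ => ℝ × ℝ) j)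
    fun ω (n : ℕ) => (aₙ (n + 1) ω, bₙ (n + 1) ω)

theorem iSup_noiseSigma_le_comap (s : Set ℕ) :
    ⨆ j ∈ s, noiseSigma ε (j + 1) ≤ MeasurableSpace.comap
      (fun ω (n : ℕ) => (ε (2 * (n + 1)) ω, ε (2 * (n + 1) + 1) ω)) inferInstance :=
  iSup₂_le fun j _ => comap_comp_le (measurable_pi_apply (X := fun _ : ℕ => ℝ × ℝ) j)
    fun ω (n : ℕ) => (ε (2 * (n + 1)) ω, ε (2 * (n + 1) + 1) ω)

variable [mΩ : MeasurableSpace Ω] {μ : Measure Ω} {a b c d : ℝ}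

namespace IsRCBAR

theorem measurable_coef (hX : IsRCBAR μ aₙ bₙ ε X a b c d) (i : Fin 2) {k : ℕ} (hk : 1 ≤ k) :
    Measurable (coef aₙ bₙ i k) := by
  fin_cases i
  · exact hX.measurable_a k hk
  · exact hX.measurable_b k hk

theorem measurable_noise (hX : IsRCBAR μ aₙ bₙ ε X a b c d) (i : Fin 2) {k : ℕ} (hk : 1 ≤ k) :
    Measurable (ε (2 * k + i)) :=
  hX.measurable_ε _ (by omega)

theorem measurable_coef_prod (hX : IsRCBAR μ aₙ bₙ ε X a b c d) {k : ℕ} (hk : 1 ≤ k) :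
    Measurable fun ω => (aₙ k ω, bₙ k ω) :=
  (hX.measurable_a k hk).prodMk (hX.measurable_b k hk)

theorem measurable_noise_prod (hX : IsRCBAR μ aₙ bₙ ε X a b c d) {k : ℕ} (hk : 1 ≤ k) :
    Measurable fun ω => (ε (2 * k) ω, ε (2 * k + 1) ω) :=
  (hX.measurable_ε _ (by omega)).prodMk (hX.measurable_ε _ (by omega))

theorem coefSigma_le (hX : IsRCBAR μ aₙ bₙ ε X a b c d) {k : ℕ} (hk : 1 ≤ k) :
    coefSigma aₙ bₙ k ≤ mΩ :=
  (hX.measurable_coef_prod hk).comap_le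

theorem noiseSigma_le (hX : IsRCBAR μ aₙ bₙ ε X a b c d) {k : ℕ} (hk : 1 ≤ k) :
    noiseSigma ε k ≤ mΩ :=
  (hX.measurable_noise_prod hk).comap_le

theorem othersSigma_le (hX : IsRCBAR μ aₙ bₙ ε X a b c d) (k : ℕ) :
    othersSigma aₙ bₙ ε X k ≤ mΩ :=
  sup_le (hX.measurable_X 1 le_rfl).comap_le
    (sup_le (iSup₂_le fun j _ => hX.coefSigma_le (Nat.le_add_left 1 j))
      (iSup₂_le fun j _ => hX.noiseSigma_le (Nat.le_add_left 1 j)))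

theorem daughter_eq (hX : IsRCBAR μ aₙ bₙ ε X a b c d) (i : Fin 2) {k : ℕ} (hk : 1 ≤ k) (ω : Ω) :
    X (2 * k + i) ω = coef aₙ bₙ i k ω * X k ω + ε (2 * k + i) ω := by
  fin_cases i
  · exact hX.even_eq k hk ω
  · exact hX.odd_eq k hk ω

/-- The effects on the daughters of `k` are independent of everything else. -/
theorem indep_othersSigma [IsProbabilityMeasure μ]
    (hX : IsRCBAR μ aₙ bₙ ε X a b c d) {k : ℕ} (hk : 1 ≤ k) :
    Indep (coefSigma aₙ bₙ k ⊔ noiseSigma ε k) (othersSigma aₙ bₙ ε X k) μ := by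
  obtain ⟨j, rfl⟩ : ∃ j, k = j + 1 := ⟨k - 1, by omega⟩
  have hle_c : ∀ s : Set ℕ, ⨆ j ∈ s, coefSigma aₙ bₙ (j + 1) ≤ mΩ := fun s =>
    iSup₂_le fun j _ => hX.coefSigma_le (Nat.le_add_left 1 j)
  have hle_n : ∀ s : Set ℕ, ⨆ j ∈ s, noiseSigma ε (j + 1) ≤ mΩ := fun s =>
    iSup₂_le fun j _ => hX.noiseSigma_le (Nat.le_add_left 1 j)
  have hdisj : Disjoint ({j} : Set ℕ) {i : ℕ | i + 1 ≠ j + 1} := by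
    rw [Set.disjoint_singleton_left]; simp
  have hc : Indep (⨆ i ∈ ({j} : Set ℕ), coefSigma aₙ bₙ (i + 1))
      (⨆ i ∈ {i : ℕ | i + 1 ≠ j + 1}, coefSigma aₙ bₙ (i + 1)) μ :=
    indep_iSup_of_disjoint (fun i => hX.coefSigma_le (Nat.le_add_left 1 i)) hX.indep_ab hdisj
  have hn : Indep (⨆ i ∈ ({j} : Set ℕ), noiseSigma ε (i + 1))
      (⨆ i ∈ {i : ℕ | i + 1 ≠ j + 1}, noiseSigma ε (i + 1)) μ :=
    indep_iSup_of_disjoint (fun i => hX.noiseSigma_le (Nat.le_add_left 1 i)) hX.indep_ε hdisj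
  have hcn := indep_sup_sup (hle_c _) (hle_c _) (hle_n _) (hle_n _)
    (indep_of_indep_of_le_left (indep_of_indep_of_le_right hX.indep_ab_ε
      (sup_le (iSup_noiseSigma_le_comap _) (iSup_noiseSigma_le_comap _)))
      (sup_le (iSup_coefSigma_le_comap _) (iSup_coefSigma_le_comap _))) hc hn
  have hle : ∀ s : Set ℕ, (⨆ j ∈ s, coefSigma aₙ bₙ (j + 1)) ⊔ (⨆ j ∈ s, noiseSigma ε (j + 1)) ≤
      MeasurableSpace.comap (fun ω => (fun n : ℕ => (aₙ (n + 1) ω, bₙ (n + 1) ω),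
        fun n : ℕ => (ε (2 * (n + 1)) ω, ε (2 * (n + 1) + 1) ω))) inferInstance := fun s =>
    sup_le ((iSup_coefSigma_le_comap s).trans (comap_comp_le measurable_fst
        fun ω => (fun n : ℕ => (aₙ (n + 1) ω, bₙ (n + 1) ω),
          fun n : ℕ => (ε (2 * (n + 1)) ω, ε (2 * (n + 1) + 1) ω))))
      ((iSup_noiseSigma_le_comap s).trans (comap_comp_le measurable_snd
        fun ω => (fun n : ℕ => (aₙ (n + 1) ω, bₙ (n + 1) ω),
          fun n : ℕ => (ε (2 * (n + 1)) ω, ε (2 * (n + 1) + 1) ω))))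
  -- A second regrouping, with `⊥` on the side of the effects of `k`, adds the ancestor to the other
  -- side only.
  have h := indep_sup_sup bot_le (hX.measurable_X 1 le_rfl).comap_le
    (sup_le (hle_c {j}) (hle_n {j}))
    (sup_le (hle_c {i | i + 1 ≠ j + 1}) (hle_n {i | i + 1 ≠ j + 1}))
    (indep_of_indep_of_le_left (indep_of_indep_of_le_right hX.indep_X_one
      (sup_le (hle _) (hle _))) (sup_le bot_le le_rfl)) (indep_bot_left _) hcn
  refine indep_of_indep_of_le_left h ?_
  simp

theorem indep_coefSigma_noiseSigma (hX : IsRCBAR μ aₙ bₙ ε X a b c d) {k : ℕ} (hk : 1 ≤ k) :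
    Indep (coefSigma aₙ bₙ k) (noiseSigma ε k) μ := by
  obtain ⟨j, rfl⟩ : ∃ j, k = j + 1 := ⟨k - 1, by omega⟩
  refine indep_of_indep_of_le_left (indep_of_indep_of_le_right hX.indep_ab_ε
    (le_trans ?_ (iSup_noiseSigma_le_comap {j}))) (le_trans ?_ (iSup_coefSigma_le_comap {j})) <;>
  simp

/-- Unrolling the recursion from `l` to the ancestor uses only the effects on the daughters of `l /
2`, `l / 4`, …, all of which are smaller than `k` when `l < 2k`. -/
theorem measurable_X_othersSigma (hX : IsRCBAR μ aₙ bₙ ε X a b c d) {k l : ℕ} (hl : 1 ≤ l)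
    (hlk : l < 2 * k) : Measurable[othersSigma aₙ bₙ ε X k] (X l) := by
  induction l using Nat.strong_induction_on with
  | _ l ih =>
    rcases hl.eq_or_lt with rfl | hl'
    · exact (comap_measurable (X 1)).mono le_sup_left le_rfl
    · obtain ⟨i, hi⟩ : ∃ i : Fin 2, l = 2 * (l / 2) + i :=
        ⟨⟨l % 2, Nat.mod_lt _ two_pos⟩, (Nat.div_add_mod l 2).symm⟩
      have h : X l = fun ω => coef aₙ bₙ i (l / 2) ω * X (l / 2) ω + ε (2 * (l / 2) + i) ω := by
        funext ω
        conv_lhs => rw [hi]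
        exact hX.daughter_eq i (by omega) ω
      rw [h]
      exact (((measurable_coef_coefSigma i _).mono
        (coefSigma_le_othersSigma (by omega) (by omega)) le_rfl).mul
        (ih (l / 2) (by omega) (by omega) (by omega))).add
        ((measurable_noise_noiseSigma i _).mono
          (noiseSigma_le_othersSigma (by omega) (by omega)) le_rfl)

/-- Every index up to generation `n` is below `2 ^ (n + 1) ≤ 2k`. Results given `othersSigma k`
thereby descend to the generation σ-algebra. -/
theorem genSigma_le_othersSigma (hX : IsRCBAR μ aₙ bₙ ε X a b c d) {n k : ℕ} (hk : k ∈ gen n) :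
    genSigma X n ≤ othersSigma aₙ bₙ ε X k := by
  refine iSup₂_le fun l hl => (hX.measurable_X_othersSigma (one_le_of_mem_tree hl) ?_).comap_le
  simp only [tree, gen, Finset.mem_biUnion, Finset.mem_range, Finset.mem_Ico] at hl hk
  obtain ⟨j, hj, -, hlj⟩ := hl
  calc l < 2 ^ (j + 1) := hlj
    _ ≤ 2 ^ (n + 1) := Nat.pow_le_pow_right two_pos (by omega)
    _ ≤ 2 * k := by rw [pow_succ]; omega

end IsRCBAR

end Model

/-! ### Power inequalities of order 16. -/

section Real

theorem abs_pow_le_one_add_pow (x : ℝ) {p : ℕ} (hp : p ≤ 16) : |x ^ p| ≤ 1 + x ^ 16 := by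
  have h16 : x ^ 16 = |x| ^ 16 := (Even.pow_abs (by decide) x).symm
  rw [abs_pow, h16]
  rcases le_total |x| 1 with h | h
  · exact (pow_le_one₀ (abs_nonneg x) h).trans (le_add_of_nonneg_right (by positivity))
  · exact (pow_le_pow_right₀ h hp).trans (by linarith)

/-- Convexity with weights `t` and `1 - t`. With `t` close to 1 the factor of `x ^ 16` is close to
1, so a moment of the coefficient below 1 still gives a contraction. -/
theorem add_pow_sixteen_le {t : ℝ} (h0 : 0 < t) (h1 : t < 1) (x y : ℝ) :
    (x + y) ^ 16 ≤ x ^ 16 / t ^ 15 + y ^ 16 / (1 - t) ^ 15 := by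
  have h1' : 0 < 1 - t := by linarith
  have h := (Even.convexOn_pow (𝕜 := ℝ) (n := 16) (by decide)).2 (Set.mem_univ (x / t))
    (Set.mem_univ (y / (1 - t))) h0.le h1'.le (by ring)
  simp only [smul_eq_mul] at h
  have e1 : t * (x / t) + (1 - t) * (y / (1 - t)) = x + y := by field_simp
  have e2 : t * (x / t) ^ 16 = x ^ 16 / t ^ 15 := by field_simp
  have e3 : (1 - t) * (y / (1 - t)) ^ 16 = y ^ 16 / (1 - t) ^ 15 := by field_simp
  rwa [e1, e2, e3] at h

theorem exists_lt_pow {r : ℝ} (h0 : 0 ≤ r) (h1 : r < 1) : ∃ t : ℝ, 0 < t ∧ t < 1 ∧ r < t ^ 15 := by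
  -- By Bernoulli, `t ^ 15 ≥ 1 - 15 (1 - r) / 16`, which exceeds `r` by `(1 - r) / 16`.
  refine ⟨1 + -((1 - r) / 16), by linarith, by linarith, ?_⟩
  have := one_add_mul_le_pow (a := -((1 - r) / 16)) (by linarith) 15
  push_cast at this
  linarith

/-- Weighted AM-GM for `|x| ^ 16` and `1`. After integration, a sixteenth moment below 1 forces all
moments of order 1 to 16 below 1 in absolute value. -/
theorem abs_pow_le_convex_comb (x : ℝ) {p : ℕ} (hp : p ≤ 16) :
    |x ^ p| ≤ p / 16 * x ^ 16 + (1 - p / 16) := by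
  have hp' : (p : ℝ) ≤ 16 := by exact_mod_cast hp
  have h16 : x ^ 16 = |x| ^ 16 := (Even.pow_abs (by decide) x).symm
  rw [abs_pow, h16]
  have h := Real.geom_mean_le_arith_mean2_weighted (w₁ := p / 16) (w₂ := 1 - p / 16)
    (p₁ := |x| ^ 16) (p₂ := 1) (by positivity) (by linarith) (by positivity) zero_le_one (by ring)
  rw [Real.one_rpow, mul_one, mul_one, ← Real.rpow_natCast, ← Real.rpow_mul (abs_nonneg x)] at h
  have e : ((16 : ℕ) : ℝ) * (p / 16) = p := by push_cast; ring
  rw [e, Real.rpow_natCast, Real.rpow_natCast] at h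
  exact h

end Real

/-! ### Moments and conditioning under independence. -/

section General

variable {Ω : Type*} {mΩ : MeasurableSpace Ω} {μ : Measure Ω}

theorem integrable_mul_of_indep {m₁ m₂ : MeasurableSpace Ω} (h : Indep m₁ m₂ μ) {f g : Ω → ℝ}
    (hf : Measurable[m₁] f) (hg : Measurable[m₂] g) (hfi : Integrable f μ) (hgi : Integrable g μ) :
    Integrable (fun ω => f ω * g ω) μ :=
  IndepFun.integrable_mul (indep_of_indep_of_le_left
    (indep_of_indep_of_le_right h hg.comap_le) hf.comap_le) hfi hgi

theorem integral_mul_of_indep {m₁ m₂ : MeasurableSpace Ω} (hm₁ : m₁ ≤ mΩ)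
    (hm₂ : m₂ ≤ mΩ) (h : Indep m₁ m₂ μ) {f g : Ω → ℝ} (hf : Measurable[m₁] f)
    (hg : Measurable[m₂] g) :
    ∫ ω, f ω * g ω ∂μ = (∫ ω, f ω ∂μ) * ∫ ω, g ω ∂μ :=
  IndepFun.integral_fun_mul_eq_mul_integral (indep_of_indep_of_le_left
    (indep_of_indep_of_le_right h hg.comap_le) hf.comap_le)
    (hf.mono hm₁ le_rfl).aestronglyMeasurable (hg.mono hm₂ le_rfl).aestronglyMeasurable

variable [IsProbabilityMeasure μ]

theorem integrable_pow_of_le {f : Ω → ℝ} (hf : AEStronglyMeasurable f μ)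
    (h : Integrable (fun ω => f ω ^ 16) μ) {p : ℕ} (hp : p ≤ 16) :
    Integrable (fun ω => f ω ^ p) μ :=
  ((integrable_const (1 : ℝ)).add h).mono' (hf.pow p)
    (Eventually.of_forall fun ω => abs_pow_le_one_add_pow (f ω) hp)

theorem abs_integral_pow_le {f : Ω → ℝ}
    (h : Integrable (fun ω => f ω ^ 16) μ) {p : ℕ} (hp : p ≤ 16) :
    |∫ ω, f ω ^ p ∂μ| ≤ 1 + ∫ ω, f ω ^ 16 ∂μ := by
  refine (norm_integral_le_of_norm_le (f := fun ω => f ω ^ p) ((integrable_const (1 : ℝ)).add h)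
    (Eventually.of_forall fun ω => abs_pow_le_one_add_pow (f ω) hp)).trans ?_
  simp only [Pi.add_apply]
  rw [integral_add (integrable_const _) h]
  simp

theorem abs_integral_pow_lt_one {f : Ω → ℝ}
    (h : Integrable (fun ω => f ω ^ 16) μ) (h1 : ∫ ω, f ω ^ 16 ∂μ < 1) {p : ℕ} (hp0 : 1 ≤ p)
    (hp : p ≤ 16) : |∫ ω, f ω ^ p ∂μ| < 1 := by
  refine (norm_integral_le_of_norm_le (f := fun ω => f ω ^ p) ((h.const_mul (p / 16 : ℝ)).add
    (integrable_const (1 - p / 16 : ℝ)))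
    (Eventually.of_forall fun ω => abs_pow_le_convex_comb (f ω) hp)).trans_lt ?_
  simp only [Pi.add_apply]
  rw [integral_add (h.const_mul _) (integrable_const _), integral_const_mul]
  have : (1 : ℝ) ≤ p := by exact_mod_cast hp0
  simp only [integral_const, probReal_univ, smul_eq_mul, one_mul]
  nlinarith

/-- Given the larger σ-algebra `m₂`, the factor `g` comes out and `f` is replaced by its mean; the
tower property then descends to `m`. -/
theorem condExp_mul_of_indep {m₁ m₂ m : MeasurableSpace Ω} (hm₁ : m₁ ≤ mΩ)
    (hm₂ : m₂ ≤ mΩ) (hm : m ≤ m₂) (h : Indep m₁ m₂ μ) {f g : Ω → ℝ} (hf : Measurable[m₁] f)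
    (hg : Measurable[m₂] g) (hfi : Integrable f μ) (hgi : Integrable g μ) :
    μ[fun ω => f ω * g ω | m] =ᵐ[μ] fun ω => (∫ ω, f ω ∂μ) * (μ[g | m]) ω := by
  have hint := integrable_mul_of_indep h hf hg hfi hgi
  have h₁ : μ[fun ω => f ω * g ω | m₂] =ᵐ[μ] fun ω => (∫ ω, f ω ∂μ) * g ω := by
    refine (condExp_mul_of_stronglyMeasurable_right hg.stronglyMeasurable hint hfi).trans ?_
    filter_upwards [condExp_indep_eq hm₁ hm₂ hf.stronglyMeasurable h] with ω hω
    simp [hω]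
  refine (condExp_condExp_of_le hm hm₂).symm.trans ((condExp_congr_ae h₁).trans ?_)
  exact condExp_smul (∫ ω, f ω ∂μ) g m

theorem condExp_mul_of_indep_of_measurable {m₁ m₂ m : MeasurableSpace Ω} (hm₁ : m₁ ≤ mΩ)
    (hm₂ : m₂ ≤ mΩ) (hm : m ≤ m₂) (h : Indep m₁ m₂ μ) {f g : Ω → ℝ} (hf : Measurable[m₁] f)
    (hg : Measurable[m] g) (hfi : Integrable f μ) (hgi : Integrable g μ) :
    μ[fun ω => f ω * g ω | m] =ᵐ[μ] fun ω => (∫ ω, f ω ∂μ) * g ω := by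
  have := condExp_mul_of_indep hm₁ hm₂ hm h hf (hg.mono hm le_rfl) hfi hgi
  rwa [condExp_of_stronglyMeasurable (hm.trans hm₂) hg.stronglyMeasurable hgi] at this

end General

/-! ### Uniform bound on the sixteenth moments. -/

section Model

variable {Ω : Type*} [mΩ : MeasurableSpace Ω] {μ : Measure Ω} {aₙ bₙ ε X : ℕ → Ω → ℝ}
  {a b c d : ℝ}

/-- The moments of the random coefficients. -/
noncomputable def coefMoment (μ : Measure Ω) (aₙ bₙ : ℕ → Ω → ℝ) (i : Fin 2) (p : ℕ) : ℝ :=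
  ∫ ω, coef aₙ bₙ i 1 ω ^ p ∂μ

/-- The moments of the environmental effects. -/
noncomputable def noiseMoment (μ : Measure Ω) (ε : ℕ → Ω → ℝ) (i : Fin 2) (p : ℕ) : ℝ :=
  ∫ ω, ε (2 * 1 + i) ω ^ p ∂μ

theorem H1.integrable_coef_pow_sixteen (h1 : H1 μ aₙ bₙ ε) (i : Fin 2) {k : ℕ} (hk : 1 ≤ k) :
    Integrable (fun ω => coef aₙ bₙ i k ω ^ 16) μ := by
  fin_cases i
  · exact h1.integrable_a k hk
  · exact h1.integrable_b k hk

theorem H1.integrable_noise_pow_sixteen (h1 : H1 μ aₙ bₙ ε) (i : Fin 2) {k : ℕ} (hk : 1 ≤ k) :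
    Integrable (fun ω => ε (2 * k + i) ω ^ 16) μ := by
  fin_cases i
  · exact (h1.moment_ε_even.choose_spec k hk).1
  · exact (h1.moment_ε_odd.choose_spec k hk).1

theorem H1.coefMoment_sixteen_lt_one (h1 : H1 μ aₙ bₙ ε) (i : Fin 2) :
    coefMoment μ aₙ bₙ i 16 < 1 := by
  fin_cases i
  · exact h1.moment_a 1 le_rfl
  · exact h1.moment_b 1 le_rfl

theorem H1.abs_coefMoment_lt_one [IsProbabilityMeasure μ] (h1 : H1 μ aₙ bₙ ε) (i : Fin 2) {p : ℕ}
    (hp0 : 1 ≤ p) (hp : p ≤ 16) : |coefMoment μ aₙ bₙ i p| < 1 :=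
  abs_integral_pow_lt_one (h1.integrable_coef_pow_sixteen i le_rfl)
    (h1.coefMoment_sixteen_lt_one i) hp0 hp

namespace IsRCBAR

theorem integral_comp_coef (hX : IsRCBAR μ aₙ bₙ ε X a b c d) {k : ℕ} (hk : 1 ≤ k)
    {φ : ℝ × ℝ → ℝ} (hφ : Measurable φ) :
    ∫ ω, φ (aₙ k ω, bₙ k ω) ∂μ = ∫ ω, φ (aₙ 1 ω, bₙ 1 ω) ∂μ :=
  ((hX.ident_ab k hk).comp hφ).integral_eq

theorem integral_comp_noise (hX : IsRCBAR μ aₙ bₙ ε X a b c d) {k : ℕ} (hk : 1 ≤ k)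
    {φ : ℝ × ℝ → ℝ} (hφ : Measurable φ) :
    ∫ ω, φ (ε (2 * k) ω, ε (2 * k + 1) ω) ∂μ = ∫ ω, φ (ε 2 ω, ε 3 ω) ∂μ :=
  ((hX.ident_ε k hk).comp hφ).integral_eq

theorem integral_coef_pow (hX : IsRCBAR μ aₙ bₙ ε X a b c d) (i : Fin 2) {k : ℕ} (hk : 1 ≤ k)
    (p : ℕ) : ∫ ω, coef aₙ bₙ i k ω ^ p ∂μ = coefMoment μ aₙ bₙ i p := by
  fin_cases i
  · exact hX.integral_comp_coef hk (φ := fun x => x.1 ^ p) (by fun_prop)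
  · exact hX.integral_comp_coef hk (φ := fun x => x.2 ^ p) (by fun_prop)

theorem integral_noise_pow (hX : IsRCBAR μ aₙ bₙ ε X a b c d) (i : Fin 2) {k : ℕ} (hk : 1 ≤ k)
    (p : ℕ) : ∫ ω, ε (2 * k + i) ω ^ p ∂μ = noiseMoment μ ε i p := by
  fin_cases i
  · exact hX.integral_comp_noise hk (φ := fun x => x.1 ^ p) (by fun_prop)
  · exact hX.integral_comp_noise hk (φ := fun x => x.2 ^ p) (by fun_prop)

variable [IsProbabilityMeasure μ]

theorem integrable_coef_pow (hX : IsRCBAR μ aₙ bₙ ε X a b c d) (h1 : H1 μ aₙ bₙ ε) (i : Fin 2)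
    {k : ℕ} (hk : 1 ≤ k) {p : ℕ} (hp : p ≤ 16) :
    Integrable (fun ω => coef aₙ bₙ i k ω ^ p) μ :=
  integrable_pow_of_le (hX.measurable_coef i hk).aestronglyMeasurable
    (h1.integrable_coef_pow_sixteen i hk) hp

theorem integrable_noise_pow (hX : IsRCBAR μ aₙ bₙ ε X a b c d) (h1 : H1 μ aₙ bₙ ε) (i : Fin 2)
    {k : ℕ} (hk : 1 ≤ k) {p : ℕ} (hp : p ≤ 16) :
    Integrable (fun ω => ε (2 * k + i) ω ^ p) μ :=
  integrable_pow_of_le (hX.measurable_noise i hk).aestronglyMeasurable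
    (h1.integrable_noise_pow_sixteen i hk) hp

/-- From mother to daughter, the sixteenth moment `y` becomes at most `q * y + B` with `q < 1`, by
convexity and independence of the coefficient and the mother. -/
theorem exists_moment_sixteen_bound (hX : IsRCBAR μ aₙ bₙ ε X a b c d) (h1 : H1 μ aₙ bₙ ε) :
    ∃ K : ℝ, ∀ k, 1 ≤ k → Integrable (fun ω => X k ω ^ 16) μ ∧ ∫ ω, X k ω ^ 16 ∂μ ≤ K := by
  have hr0 : 0 ≤ max (coefMoment μ aₙ bₙ 0 16) (coefMoment μ aₙ bₙ 1 16) :=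
    le_max_of_le_left (integral_nonneg fun ω => Even.pow_nonneg (by decide) _)
  have hr1 : max (coefMoment μ aₙ bₙ 0 16) (coefMoment μ aₙ bₙ 1 16) < 1 :=
    max_lt (h1.coefMoment_sixteen_lt_one 0) (h1.coefMoment_sixteen_lt_one 1)
  have hri : ∀ i : Fin 2, coefMoment μ aₙ bₙ i 16 ≤
      max (coefMoment μ aₙ bₙ 0 16) (coefMoment μ aₙ bₙ 1 16) := by
    intro i; fin_cases i
    · exact le_max_left _ _
    · exact le_max_right _ _
  have hEi : ∀ i : Fin 2, noiseMoment μ ε i 16 ≤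
      max (noiseMoment μ ε 0 16) (noiseMoment μ ε 1 16) := by
    intro i; fin_cases i
    · exact le_max_left _ _
    · exact le_max_right _ _
  generalize max (coefMoment μ aₙ bₙ 0 16) (coefMoment μ aₙ bₙ 1 16) = r at *
  generalize max (noiseMoment μ ε 0 16) (noiseMoment μ ε 1 16) = E at *
  obtain ⟨t, ht0, ht1, hrt⟩ := exists_lt_pow hr0 hr1
  have ht1' : 0 < 1 - t := by linarith
  set B := E / (1 - t) ^ 15 with hB
  have hq : r / t ^ 15 < 1 := (div_lt_one (by positivity)).2 hrt
  have hq0 : 0 ≤ r / t ^ 15 := by positivity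
  set q := r / t ^ 15 with hqdef
  -- `B / (1 - q)` is the fixed point of `y ↦ q * y + B`; the maximum with the ancestor's moment is
  -- stable under this map and starts the induction.
  set K := max (∫ ω, X 1 ω ^ 16 ∂μ) (B / (1 - q)) with hK
  have hBK : q * K + B ≤ K := by
    have : B / (1 - q) ≤ K := le_max_right _ _
    rw [div_le_iff₀ (by linarith)] at this
    linarith
  have hK0 : 0 ≤ K := le_max_of_le_left (integral_nonneg fun ω => Even.pow_nonneg (by decide) _)
  refine ⟨K, fun k hk => ?_⟩
  induction k using Nat.strong_induction_on with
  | _ k ih =>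
    rcases hk.eq_or_lt with rfl | hk'
    · exact ⟨hX.integrable_X_one, le_max_left _ _⟩
    · obtain ⟨i, l, hl, rfl⟩ : ∃ (i : Fin 2) (l : ℕ), 1 ≤ l ∧ k = 2 * l + i :=
        ⟨⟨k % 2, Nat.mod_lt _ two_pos⟩, k / 2, by omega, (Nat.div_add_mod k 2).symm⟩
      obtain ⟨hi, hle⟩ := ih l (by omega) hl
      have hind := hX.indep_othersSigma hl
      have hmc : Measurable[coefSigma aₙ bₙ l ⊔ noiseSigma ε l]
          fun ω => coef aₙ bₙ i l ω ^ 16 :=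
        ((measurable_coef_coefSigma i l).mono le_sup_left le_rfl).pow_const 16
      have hmX : Measurable[othersSigma aₙ bₙ ε X l] fun ω => X l ω ^ 16 :=
        (hX.measurable_X_othersSigma hl (by omega)).pow_const 16
      have hle1 : coefSigma aₙ bₙ l ⊔ noiseSigma ε l ≤ mΩ :=
        sup_le (hX.coefSigma_le hl) (hX.noiseSigma_le hl)
      have hI := integrable_mul_of_indep hind hmc hmX
        (h1.integrable_coef_pow_sixteen i hl) hi
      have hI2 := integral_mul_of_indep hle1 (hX.othersSigma_le l) hind hmc hmX
      rw [hX.integral_coef_pow i hl] at hI2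
      have hbd : Integrable (fun ω => coef aₙ bₙ i l ω ^ 16 * X l ω ^ 16 / t ^ 15 +
          ε (2 * l + i) ω ^ 16 / (1 - t) ^ 15) μ :=
        (hI.div_const _).add ((h1.integrable_noise_pow_sixteen i hl).div_const _)
      have hpt : ∀ ω, X (2 * l + i) ω ^ 16 ≤ coef aₙ bₙ i l ω ^ 16 * X l ω ^ 16 / t ^ 15 +
          ε (2 * l + i) ω ^ 16 / (1 - t) ^ 15 := fun ω => by
        rw [hX.daughter_eq i hl ω, ← mul_pow]
        exact add_pow_sixteen_le ht0 ht1 _ _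
      have hint : Integrable (fun ω => X (2 * l + i) ω ^ 16) μ := by
        refine hbd.mono' ((hX.measurable_X _ hk).pow_const 16).aestronglyMeasurable
          (Eventually.of_forall fun ω => ?_)
        rw [Real.norm_of_nonneg (Even.pow_nonneg (by decide) _)]
        exact hpt ω
      refine ⟨hint, (integral_mono hint hbd hpt).trans (le_trans ?_ hBK)⟩
      rw [integral_add (hI.div_const _) ((h1.integrable_noise_pow_sixteen i hl).div_const _),
        integral_div, integral_div, hI2, hX.integral_noise_pow i hl]
      have hX0 : 0 ≤ ∫ ω, X l ω ^ 16 ∂μ := integral_nonneg fun ω => Even.pow_nonneg (by decide) _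
      refine add_le_add ?_ (div_le_div_of_nonneg_right (hEi i) (by positivity))
      calc coefMoment μ aₙ bₙ i 16 * (∫ ω, X l ω ^ 16 ∂μ) / t ^ 15
          ≤ r * K / t ^ 15 :=
            div_le_div_of_nonneg_right (mul_le_mul (hri i) hle hX0 hr0) (by positivity)
        _ = q * K := (div_mul_eq_mul_div r (t ^ 15) K).symm

theorem integrable_X_pow (hX : IsRCBAR μ aₙ bₙ ε X a b c d) (h1 : H1 μ aₙ bₙ ε)
    {k : ℕ} (hk : 1 ≤ k) {p : ℕ} (hp : p ≤ 16) : Integrable (fun ω => X k ω ^ p) μ :=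
  integrable_pow_of_le (hX.measurable_X k hk).aestronglyMeasurable
    ((hX.exists_moment_sixteen_bound h1).choose_spec k hk).1 hp

theorem exists_moment_bound (hX : IsRCBAR μ aₙ bₙ ε X a b c d) (h1 : H1 μ aₙ bₙ ε) :
    ∃ K : ℝ, ∀ k, 1 ≤ k → ∀ p ≤ 16, ∫ ω, X k ω ^ p ∂μ ≤ K := by
  obtain ⟨K, hK⟩ := hX.exists_moment_sixteen_bound h1
  refine ⟨1 + K, fun k hk p hp => (le_abs_self _).trans
    ((abs_integral_pow_le (hK k hk).1 hp).trans ?_)⟩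
  linarith [(hK k hk).2]

end IsRCBAR

end Model

/-! ### Affine recursions and averages over the tree. -/

section Real

/-- Once `v` is below `δ / 2 * (1 - ρ)`, the level `δ / 2` is preserved by the recursion and any
excess over it decays like `ρ ^ m`. -/
theorem tendsto_zero_of_le_mul_add {y v : ℕ → ℝ} {ρ : ℝ} (hρ0 : 0 ≤ ρ) (hρ1 : ρ < 1)
    (hy : ∀ n, 0 ≤ y n) (hle : ∀ n, y (n + 1) ≤ ρ * y n + v n) (hv : Tendsto v atTop (𝓝 0)) :
    Tendsto y atTop (𝓝 0) := by
  have h1 : 0 < 1 - ρ := by linarith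
  refine Metric.tendsto_atTop.2 fun δ hδ => ?_
  obtain ⟨N, hN⟩ := eventually_atTop.1
    (hv.eventually (gt_mem_nhds (show 0 < δ / 2 * (1 - ρ) by positivity)))
  have hstep : ∀ m, y (N + m) ≤ ρ ^ m * y N + δ / 2 := by
    intro m
    induction m with
    | zero => simp; linarith
    | succ m ih =>
      have h2 := hle (N + m)
      have h3 := hN (N + m) (Nat.le_add_right _ _)
      have h4 := mul_le_mul_of_nonneg_left ih hρ0
      rw [← add_assoc, pow_succ]
      nlinarith
  have hlim : Tendsto (fun m : ℕ => ρ ^ m * y N) atTop (𝓝 0) := by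
    simpa using (tendsto_pow_atTop_nhds_zero_of_lt_one hρ0 hρ1).mul_const (y N)
  obtain ⟨m₀, hm₀⟩ := eventually_atTop.1 (hlim.eventually (gt_mem_nhds (half_pos hδ)))
  refine ⟨N + m₀, fun n hn => ?_⟩
  obtain ⟨m, rfl⟩ : ∃ m, n = N + m := ⟨n - N, by omega⟩
  have h5 := hm₀ m (by omega)
  rw [Real.dist_eq, sub_zero, abs_of_nonneg (hy _)]
  linarith [hstep m]

/-- A stable affine recursion whose forcing term converges, converges to the fixed point. -/
theorem tendsto_of_affine_recursion {x u : ℕ → ℝ} {r l u₀ : ℝ} (hr : |r| < 1)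
    (hx : ∀ n, x (n + 1) = r * x n + u n) (hu : Tendsto u atTop (𝓝 u₀)) (hl : l = r * l + u₀) :
    Tendsto x atTop (𝓝 l) := by
  rw [tendsto_iff_dist_tendsto_zero]
  refine tendsto_zero_of_le_mul_add (abs_nonneg r) hr (fun n => dist_nonneg) (fun n => ?_)
    (tendsto_iff_dist_tendsto_zero.1 hu)
  simp only [Real.dist_eq]
  rw [hx n, ← abs_mul]
  refine le_trans (le_of_eq ?_) (abs_add_le _ _)
  congr 1
  linarith

theorem sum_Ico_two_mul (f : ℕ → ℝ) {m n : ℕ} (h : m ≤ n) :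
    ∑ k ∈ Finset.Ico (2 * m) (2 * n), f k =
      ∑ k ∈ Finset.Ico m n, ∑ i : Fin 2, f (2 * k + i) := by
  induction n, h using Nat.le_induction with
  | base => simp
  | succ n h ih =>
    rw [Finset.sum_Ico_succ_top h, ← ih, mul_add, mul_one, Finset.sum_Ico_succ_top (by omega),
      Finset.sum_Ico_succ_top (by omega)]
    simp [add_assoc]

theorem sum_gen_succ (f : ℕ → ℝ) (n : ℕ) :
    ∑ k ∈ gen (n + 1), f k = ∑ k ∈ gen n, ∑ i : Fin 2, f (2 * k + i) := by
  have h := sum_Ico_two_mul f (Nat.pow_le_pow_right two_pos (Nat.le_succ n))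
  rwa [← pow_succ', ← pow_succ'] at h

theorem card_gen (n : ℕ) : (gen n).card = 2 ^ n := by
  simp [gen, pow_succ]; omega

theorem one_le_of_mem_gen {n k : ℕ} (hk : k ∈ gen n) : 1 ≤ k :=
  Nat.one_le_two_pow.trans (Finset.mem_Ico.1 hk).1

theorem tree_eq_Ico (n : ℕ) : tree n = Finset.Ico 1 (2 ^ (n + 1)) := by
  induction n with
  | zero => simp [tree, gen]
  | succ n ih =>
    have h : tree (n + 1) = tree n ∪ gen (n + 1) := by
      simp only [tree, Finset.range_add_one (n := n + 1), Finset.biUnion_insert]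
      exact Finset.union_comm _ _
    rw [h, ih, gen, Finset.Ico_union_Ico_eq_Ico Nat.one_le_two_pow
      (Nat.pow_le_pow_right two_pos (Nat.le_succ _))]

theorem card_tree (n : ℕ) : ((tree n).card : ℝ) = 2 ^ (n + 1) - 1 := by
  rw [tree_eq_Ico, Nat.card_Ico, Nat.cast_sub Nat.one_le_two_pow]
  push_cast; ring

/-- If the generation averages converge, then so do the tree averages. -/
theorem tendsto_tree_average {f : ℕ → ℝ} {l : ℝ}
    (h : Tendsto (fun n => ((2 : ℝ) ^ n)⁻¹ * ∑ k ∈ gen n, f k) atTop (𝓝 l)) :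
    Tendsto (fun n => ((tree n).card : ℝ)⁻¹ * ∑ j ∈ Finset.range (n + 1), ∑ k ∈ gen j, f k)
      atTop (𝓝 l) := by
  -- Cumulative sums divided by `2 ^ n` are halved at each generation, then receive the new
  -- generation average; the fixed point is `2 * l`. The tree has `2 ^ (n + 1) - 1` elements, hence
  -- the correction `(2 - 2⁻ⁿ)⁻¹` below.
  have h1 : Tendsto (fun n => ((2 : ℝ) ^ n)⁻¹ * ∑ j ∈ Finset.range (n + 1), ∑ k ∈ gen j, f k)
      atTop (𝓝 (2 * l)) := by
    refine tendsto_of_affine_recursion (r := 1 / 2) (by rw [abs_of_pos] <;> norm_num)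
      (fun n => ?_) ((tendsto_add_atTop_iff_nat 1).2 h) (by ring)
    rw [Finset.sum_range_succ _ (n + 1), mul_add, pow_succ, mul_inv]
    ring
  have h2 : Tendsto (fun n : ℕ => (2 - ((1 : ℝ) / 2) ^ n)⁻¹) atTop (𝓝 2⁻¹) := by
    have := (tendsto_pow_atTop_nhds_zero_of_lt_one (r := (1 : ℝ) / 2) (by norm_num)
      (by norm_num)).const_sub 2
    rw [sub_zero] at this
    exact this.inv₀ two_ne_zero
  have h3 := h2.mul h1
  rw [inv_mul_cancel_left₀ two_ne_zero] at h3
  refine h3.congr fun n => ?_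
  rw [card_tree, ← mul_assoc, ← mul_inv]
  congr 2
  rw [sub_mul, ← mul_pow]
  norm_num [pow_succ]; ring

end Real

/-! ### Almost sure convergence and orthogonality. -/

section General

variable {Ω : Type*} {mΩ : MeasurableSpace Ω} {μ : Measure Ω}

/-- By Tonelli the sum of the series has finite integral, so the series converges almost surely and
its terms vanish. -/
theorem ae_tendsto_zero_of_summable_integral {f : ℕ → Ω → ℝ} (hf : ∀ n, Integrable (f n) μ)
    (h0 : ∀ n ω, 0 ≤ f n ω) (hs : Summable fun n => ∫ ω, f n ω ∂μ) :
    ∀ᵐ ω ∂μ, Tendsto (fun n => f n ω) atTop (𝓝 0) := by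
  have hfin : ∫⁻ ω, ∑' n, ENNReal.ofReal (f n ω) ∂μ ≠ ⊤ := by
    rw [lintegral_tsum fun n => (hf n).1.aemeasurable.ennreal_ofReal]
    simp_rw [← ofReal_integral_eq_lintegral_ofReal (hf _) (Eventually.of_forall (h0 _))]
    exact hs.tsum_ofReal_ne_top
  filter_upwards [ae_lt_top' (AEMeasurable.tsum
    fun n => (hf n).1.aemeasurable.ennreal_ofReal) hfin] with ω hω
  have h := ENNReal.tendsto_atTop_zero_of_tsum_ne_top hω.ne
  have h' := (ENNReal.tendsto_toReal ENNReal.zero_ne_top).comp h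
  refine h'.congr fun n => ?_
  simp [ENNReal.toReal_ofReal (h0 n ω)]

theorem memLp_two_of_pow {f : Ω → ℝ} (hf : AEStronglyMeasurable f μ) (p : ℕ)
    (h : Integrable (fun ω => f ω ^ (2 * p)) μ) : MemLp (fun ω => f ω ^ p) 2 μ := by
  refine (memLp_two_iff_integrable_sq (hf.pow p)).2 (h.congr (Eventually.of_forall fun ω => ?_))
  simp only [Pi.pow_apply]
  rw [← pow_mul, mul_comm]

variable [IsProbabilityMeasure μ]

theorem integral_sub_condExp_sq_le {m : MeasurableSpace Ω} (hm : m ≤ mΩ) {f : Ω → ℝ}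
    (hf : MemLp f 2 μ) : ∫ ω, (f ω - (μ[f | m]) ω) ^ 2 ∂μ ≤ ∫ ω, f ω ^ 2 ∂μ := by
  have h1 : ∫ ω, (f ω - (μ[f | m]) ω) ^ 2 ∂μ = ∫ ω, condVar m f μ ω ∂μ :=
    (integral_condExp hm).symm
  have h2 : ∫ ω, f ω ^ 2 ∂μ = ∫ ω, (μ[f ^ 2 | m]) ω ∂μ := (integral_condExp hm).symm
  rw [h1, h2]
  exact integral_mono_ae integrable_condVar integrable_condExp (condVar_ae_le_condExp_sq hm hf)

/-- Given `m` the factor `g` comes out and `f` has mean zero; the tower property brings this down to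
`m'`. -/
theorem condExp_mul_eq_zero {m m' : MeasurableSpace Ω} (hm' : m' ≤ m) (hm : m ≤ mΩ) {f g : Ω → ℝ}
    (hf : MemLp f 2 μ) (hg : MemLp g 2 μ) (hgm : AEStronglyMeasurable[m] g μ)
    (hf0 : μ[f | m] =ᵐ[μ] 0) : μ[fun ω => f ω * g ω | m'] =ᵐ[μ] 0 := by
  have hint : Integrable (fun ω => f ω * g ω) μ := hf.integrable_mul hg
  have h : μ[fun ω => f ω * g ω | m] =ᵐ[μ] 0 := by
    refine (condExp_mul_of_aestronglyMeasurable_right hgm hint (hf.integrable one_le_two)).trans ?_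
    filter_upwards [hf0] with ω hω
    simp [hω]
  refine (condExp_condExp_of_le hm' hm).symm.trans ((condExp_congr_ae h).trans ?_)
  rw [condExp_zero]

theorem integral_mul_eq_zero_of_condExp {m : MeasurableSpace Ω} (hm : m ≤ mΩ) {f g : Ω → ℝ}
    (hf : MemLp f 2 μ) (hg : MemLp g 2 μ) (hgm : AEStronglyMeasurable[m] g μ)
    (hf0 : μ[f | m] =ᵐ[μ] 0) : ∫ ω, f ω * g ω ∂μ = 0 := by
  rw [← integral_condExp hm, integral_congr_ae (condExp_mul_eq_zero le_rfl hm hf hg hgm hf0)]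
  simp

end General

/-! ### Law of large numbers for powers. -/

section Model

variable {Ω : Type*} [mΩ : MeasurableSpace Ω] {μ : Measure Ω} {aₙ bₙ ε X : ℕ → Ω → ℝ}
  {a b c d : ℝ}

/-- The coefficient of `x ^ j` in the conditional `p`-th moment of the `i`-th daughter of an
individual with value `x`. -/
noncomputable def momentCoef (μ : Measure Ω) (aₙ bₙ ε : ℕ → Ω → ℝ) (i : Fin 2) (p j : ℕ) : ℝ :=
  coefMoment μ aₙ bₙ i j * noiseMoment μ ε i (p - j) * p.choose j

/-- The conditional `p`-th moment of the `i`-th daughter of an individual with value `x`. -/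
noncomputable def momentPoly (μ : Measure Ω) (aₙ bₙ ε : ℕ → Ω → ℝ) (i : Fin 2) (p : ℕ)
    (x : ℝ) : ℝ :=
  ∑ j ∈ Finset.range (p + 1), momentCoef μ aₙ bₙ ε i p j * x ^ j

/-- The fluctuation of the sum of the `p`-th powers of the daughters of `k`. -/
noncomputable def fluct (μ : Measure Ω) (aₙ bₙ ε X : ℕ → Ω → ℝ) (p k : ℕ) (ω : Ω) : ℝ :=
  ∑ i : Fin 2, X (2 * k + i) ω ^ p - ∑ i, momentPoly μ aₙ bₙ ε i p (X k ω)

theorem measurable_momentPoly (i : Fin 2) (p : ℕ) : Measurable (momentPoly μ aₙ bₙ ε i p) := by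
  unfold momentPoly
  fun_prop

namespace IsRCBAR

theorem effectsSigma_le (hX : IsRCBAR μ aₙ bₙ ε X a b c d) {k : ℕ} (hk : 1 ≤ k) :
    coefSigma aₙ bₙ k ⊔ noiseSigma ε k ≤ mΩ :=
  sup_le (hX.coefSigma_le hk) (hX.noiseSigma_le hk)

theorem measurable_fluct_othersSigma (hX : IsRCBAR μ aₙ bₙ ε X a b c d) {k l : ℕ} (hl : 1 ≤ l)
    (hlk : l < k) (p : ℕ) : Measurable[othersSigma aₙ bₙ ε X k] (fluct μ aₙ bₙ ε X p l) :=
  (Finset.measurable_fun_sum _ fun i _ =>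
    (hX.measurable_X_othersSigma (by omega) (by omega)).pow_const p).sub
    (Finset.measurable_fun_sum _ fun i _ =>
      (measurable_momentPoly i p).comp (hX.measurable_X_othersSigma hl (by omega)))

variable [IsProbabilityMeasure μ]

/-- In the binomial expansion each term is a function of the effects times a power of `X k`. Given
`othersSigma k` the former becomes its mean, and the mean splits since coefficient and noise are
independent. -/
theorem condExp_daughter_pow (hX : IsRCBAR μ aₙ bₙ ε X a b c d) (h1 : H1 μ aₙ bₙ ε) (i : Fin 2)
    {k : ℕ} (hk : 1 ≤ k) {p : ℕ} (hp : p ≤ 16) :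
    μ[fun ω => X (2 * k + i) ω ^ p | othersSigma aₙ bₙ ε X k] =ᵐ[μ]
      fun ω => momentPoly μ aₙ bₙ ε i p (X k ω) := by
  have hXm := hX.measurable_X_othersSigma hk (show k < 2 * k by omega)
  set F : ℕ → Ω → ℝ := fun j ω =>
    (coef aₙ bₙ i k ω ^ j * ε (2 * k + i) ω ^ (p - j)) * p.choose j
  have hFm : ∀ j, Measurable[coefSigma aₙ bₙ k ⊔ noiseSigma ε k] (F j) := fun j =>
    ((((measurable_coef_coefSigma i k).mono le_sup_left le_rfl).pow_const j).mul
      (((measurable_noise_noiseSigma i k).mono le_sup_right le_rfl).pow_const (p - j))).mul_const _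
  have hFi : ∀ j ≤ p, Integrable (F j) μ := fun j hj =>
    (integrable_mul_of_indep (hX.indep_coefSigma_noiseSigma hk)
      ((measurable_coef_coefSigma i k).pow_const j)
      ((measurable_noise_noiseSigma i k).pow_const (p - j))
      (hX.integrable_coef_pow h1 i hk (hj.trans hp))
      (hX.integrable_noise_pow h1 i hk ((Nat.sub_le _ _).trans hp))).mul_const _
  have hFint : ∀ j, ∫ ω, F j ω ∂μ = momentCoef μ aₙ bₙ ε i p j := fun j => by
    rw [momentCoef, integral_mul_const, integral_mul_of_indep (hX.coefSigma_le hk)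
      (hX.noiseSigma_le hk) (hX.indep_coefSigma_noiseSigma hk)
      ((measurable_coef_coefSigma i k).pow_const j)
      ((measurable_noise_noiseSigma i k).pow_const (p - j)), hX.integral_coef_pow i hk,
      hX.integral_noise_pow i hk]
  have hexp : (fun ω => X (2 * k + i) ω ^ p) =
      ∑ j ∈ Finset.range (p + 1), fun ω => F j ω * X k ω ^ j := by
    funext ω
    rw [hX.daughter_eq i hk ω, add_pow, Finset.sum_apply]
    refine Finset.sum_congr rfl fun j _ => ?_
    simp only [F]
    rw [mul_pow]; ring
  have hterm : ∀ j ∈ Finset.range (p + 1), μ[fun ω => F j ω * X k ω ^ j | othersSigma aₙ bₙ ε X k] =ᵐ[μ]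
      fun ω => momentCoef μ aₙ bₙ ε i p j * X k ω ^ j := fun j hj => by
    have hj' : j ≤ p := by simpa [Nat.lt_succ_iff] using hj
    rw [← hFint j]
    exact condExp_mul_of_indep_of_measurable (hX.effectsSigma_le hk) (hX.othersSigma_le k) le_rfl
      (hX.indep_othersSigma hk) (hFm j) (hXm.pow_const j) (hFi j hj')
      (hX.integrable_X_pow h1 hk (hj'.trans hp))
  rw [hexp]
  refine (condExp_finsetSum (fun j hj => ?_) _).trans ?_
  · have hj' : j ≤ p := by simpa [Nat.lt_succ_iff] using hj
    exact integrable_mul_of_indep (hX.indep_othersSigma hk) (hFm j)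
      (hXm.pow_const j) (hFi j hj') (hX.integrable_X_pow h1 hk (hj'.trans hp))
  · filter_upwards [(Finset.eventually_all _).2 hterm] with ω hω
    rw [Finset.sum_apply, momentPoly]
    exact Finset.sum_congr rfl hω

theorem memLp_X_pow (hX : IsRCBAR μ aₙ bₙ ε X a b c d) (h1 : H1 μ aₙ bₙ ε)
    {k : ℕ} (hk : 1 ≤ k) {p : ℕ} (hp : p ≤ 8) : MemLp (fun ω => X k ω ^ p) 2 μ :=
  memLp_two_of_pow (hX.measurable_X k hk).aestronglyMeasurable p
    (hX.integrable_X_pow h1 hk (by omega))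

theorem memLp_sum_daughter_pow (hX : IsRCBAR μ aₙ bₙ ε X a b c d) (h1 : H1 μ aₙ bₙ ε)
    {k : ℕ} (hk : 1 ≤ k) {p : ℕ} (hp : p ≤ 8) :
    MemLp (fun ω => ∑ i : Fin 2, X (2 * k + i) ω ^ p) 2 μ :=
  memLp_finsetSum _ fun _ _ => hX.memLp_X_pow h1 (by omega) hp

theorem memLp_fluct (hX : IsRCBAR μ aₙ bₙ ε X a b c d) (h1 : H1 μ aₙ bₙ ε)
    {k : ℕ} (hk : 1 ≤ k) {p : ℕ} (hp : p ≤ 8) : MemLp (fluct μ aₙ bₙ ε X p k) 2 μ := by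
  refine (hX.memLp_sum_daughter_pow h1 hk hp).sub (memLp_finsetSum _ fun i _ =>
    memLp_finsetSum _ fun j hj => (hX.memLp_X_pow h1 hk ?_).const_mul _)
  have := Finset.mem_range.1 hj
  omega

theorem condExp_sum_daughter_pow (hX : IsRCBAR μ aₙ bₙ ε X a b c d) (h1 : H1 μ aₙ bₙ ε)
    {k : ℕ} (hk : 1 ≤ k) {p : ℕ} (hp : p ≤ 16) :
    μ[fun ω => ∑ i : Fin 2, X (2 * k + i) ω ^ p | othersSigma aₙ bₙ ε X k] =ᵐ[μ]
      fun ω => ∑ i, momentPoly μ aₙ bₙ ε i p (X k ω) := by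
  have e : (fun ω => ∑ i : Fin 2, X (2 * k + i) ω ^ p) =
      ∑ i : Fin 2, fun ω => X (2 * k + i) ω ^ p := by
    funext ω; simp
  rw [e]
  refine (condExp_finsetSum (fun i _ => hX.integrable_X_pow h1 (by omega) hp) _).trans ?_
  filter_upwards [ae_all_iff.2 fun i : Fin 2 => hX.condExp_daughter_pow h1 i hk hp] with ω hω
  rw [Finset.sum_apply]
  exact Finset.sum_congr rfl fun i _ => hω i

theorem condExp_fluct (hX : IsRCBAR μ aₙ bₙ ε X a b c d) (h1 : H1 μ aₙ bₙ ε)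
    {k : ℕ} (hk : 1 ≤ k) {p : ℕ} (hp : p ≤ 8) :
    μ[fluct μ aₙ bₙ ε X p k | othersSigma aₙ bₙ ε X k] =ᵐ[μ] 0 := by
  have hm : Measurable[othersSigma aₙ bₙ ε X k]
      fun ω => ∑ i, momentPoly μ aₙ bₙ ε i p (X k ω) :=
    Finset.measurable_fun_sum _ fun i _ =>
      (measurable_momentPoly i p).comp (hX.measurable_X_othersSigma hk (by omega))
  have hY := (hX.memLp_sum_daughter_pow h1 hk hp).integrable one_le_two
  have hQ : Integrable (fun ω => ∑ i, momentPoly μ aₙ bₙ ε i p (X k ω)) μ := by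
    refine integrable_finsetSum _ fun i _ => integrable_finsetSum _ fun j hj =>
      (hX.integrable_X_pow h1 hk ?_).const_mul _
    have := Finset.mem_range.1 hj
    omega
  refine (condExp_sub hY hQ _).trans ?_
  rw [condExp_of_stronglyMeasurable (hX.othersSigma_le k) hm.stronglyMeasurable hQ]
  filter_upwards [hX.condExp_sum_daughter_pow h1 hk (hp.trans (by norm_num))] with ω hω
  rw [Pi.sub_apply, hω, sub_self, Pi.zero_apply]

/-- The fluctuation with the larger index is conditionally centered given a σ-algebra for which the
other one is measurable. -/
theorem integral_fluct_mul (hX : IsRCBAR μ aₙ bₙ ε X a b c d) (h1 : H1 μ aₙ bₙ ε)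
    {k l : ℕ} (hk : 1 ≤ k) (hl : 1 ≤ l) (hkl : k ≠ l) {p : ℕ} (hp : p ≤ 8) :
    ∫ ω, fluct μ aₙ bₙ ε X p k ω * fluct μ aₙ bₙ ε X p l ω ∂μ = 0 := by
  wlog h : l < k generalizing k l
  · simp_rw [mul_comm (fluct μ aₙ bₙ ε X p k _)]
    exact this hl hk hkl.symm (by omega)
  exact integral_mul_eq_zero_of_condExp (hX.othersSigma_le k) (hX.memLp_fluct h1 hk hp)
    (hX.memLp_fluct h1 hl hp)
    (hX.measurable_fluct_othersSigma hl h p).stronglyMeasurable.aestronglyMeasurable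
    (hX.condExp_fluct h1 hk hp)

/-- Subtracting a conditional mean does not increase the second moment, so moments of order `2 * p ≤
16` suffice; this is where `p ≤ 8` comes from. -/
theorem exists_integral_fluct_sq_le (hX : IsRCBAR μ aₙ bₙ ε X a b c d) (h1 : H1 μ aₙ bₙ ε)
    {p : ℕ} (hp : p ≤ 8) :
    ∃ K : ℝ, ∀ k, 1 ≤ k → ∫ ω, fluct μ aₙ bₙ ε X p k ω ^ 2 ∂μ ≤ K := by
  obtain ⟨K, hK⟩ := hX.exists_moment_bound h1
  refine ⟨2 * (K + K), fun k hk => ?_⟩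
  have hY := hX.memLp_sum_daughter_pow h1 hk hp
  have e1 : ∫ ω, fluct μ aₙ bₙ ε X p k ω ^ 2 ∂μ =
      ∫ ω, ((fun ω => ∑ i : Fin 2, X (2 * k + i) ω ^ p) ω -
        (μ[fun ω => ∑ i : Fin 2, X (2 * k + i) ω ^ p | othersSigma aₙ bₙ ε X k]) ω) ^ 2 ∂μ := by
    refine integral_congr_ae ?_
    filter_upwards [hX.condExp_sum_daughter_pow h1 hk (hp.trans (by norm_num))] with ω hω
    rw [hω, fluct]
  rw [e1]
  refine (integral_sub_condExp_sq_le (hX.othersSigma_le k) hY).trans ?_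
  have hi : ∀ i : Fin 2, Integrable (fun ω => X (2 * k + i) ω ^ (2 * p)) μ := fun i =>
    hX.integrable_X_pow h1 (by omega) (by omega)
  have hbd : Integrable (fun ω => 2 * (X (2 * k + (0 : Fin 2)) ω ^ (2 * p) +
      X (2 * k + (1 : Fin 2)) ω ^ (2 * p))) μ := ((hi 0).add (hi 1)).const_mul 2
  refine (integral_mono hY.integrable_sq hbd fun ω => ?_).trans ?_
  · simp only [Fin.sum_univ_two]
    rw [mul_comm 2 p, pow_mul, pow_mul]
    nlinarith [sq_nonneg (X (2 * k + (0 : Fin 2)) ω ^ p - X (2 * k + (1 : Fin 2)) ω ^ p)]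
  · rw [integral_const_mul, integral_add (hi 0) (hi 1)]
    have := hK (2 * k + (0 : Fin 2)) (by omega) (2 * p) (by omega)
    have := hK (2 * k + (1 : Fin 2)) (by omega) (2 * p) (by omega)
    linarith

theorem ae_tendsto_fluct_average (hX : IsRCBAR μ aₙ bₙ ε X a b c d) (h1 : H1 μ aₙ bₙ ε)
    {p : ℕ} (hp : p ≤ 8) :
    ∀ᵐ ω ∂μ, Tendsto (fun n => ((2 : ℝ) ^ n)⁻¹ * ∑ k ∈ gen n, fluct μ aₙ bₙ ε X p k ω) atTop
      (𝓝 0) := by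
  obtain ⟨K, hK⟩ := hX.exists_integral_fluct_sq_le h1 hp
  have hmul : ∀ n, ∀ k ∈ gen n, ∀ l ∈ gen n,
      Integrable (fun ω => fluct μ aₙ bₙ ε X p k ω * fluct μ aₙ bₙ ε X p l ω) μ :=
    fun n k hk l hl => (hX.memLp_fluct h1 (one_le_of_mem_gen hk) hp).integrable_mul
      (hX.memLp_fluct h1 (one_le_of_mem_gen hl) hp)
  have hsq : ∀ n, (fun ω => (((2 : ℝ) ^ n)⁻¹ * ∑ k ∈ gen n, fluct μ aₙ bₙ ε X p k ω) ^ 2) =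
      fun ω => ((4 : ℝ) ^ n)⁻¹ * ∑ k ∈ gen n, ∑ l ∈ gen n,
        fluct μ aₙ bₙ ε X p k ω * fluct μ aₙ bₙ ε X p l ω := fun n => by
    funext ω
    rw [mul_pow, sq (∑ k ∈ gen n, _), Finset.sum_mul_sum, inv_pow, ← pow_mul, mul_comm n 2, pow_mul]
    norm_num
  have hint : ∀ n, Integrable
      (fun ω => (((2 : ℝ) ^ n)⁻¹ * ∑ k ∈ gen n, fluct μ aₙ bₙ ε X p k ω) ^ 2) μ := fun n => by
    rw [hsq]
    exact (integrable_finsetSum _ fun k hk => integrable_finsetSum _ fun l hl =>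
      hmul n k hk l hl).const_mul _
  have hle : ∀ n, ∫ ω, (((2 : ℝ) ^ n)⁻¹ * ∑ k ∈ gen n, fluct μ aₙ bₙ ε X p k ω) ^ 2 ∂μ ≤
      K * (1 / 2) ^ n := fun n => by
    rw [hsq, integral_const_mul, integral_finsetSum _ fun k hk => integrable_finsetSum _
      fun l hl => hmul n k hk l hl]
    -- Only the `2 ^ n` diagonal terms survive, against the normalization `4 ^ n`.
    have h2 : ∑ k ∈ gen n, ∫ ω, ∑ l ∈ gen n,
        fluct μ aₙ bₙ ε X p k ω * fluct μ aₙ bₙ ε X p l ω ∂μ ≤ ∑ k ∈ gen n, K := by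
      refine Finset.sum_le_sum fun k hk => ?_
      rw [integral_finsetSum _ fun l hl => hmul n k hk l hl, Finset.sum_eq_single_of_mem k hk
        fun l hl hlk => hX.integral_fluct_mul h1 (one_le_of_mem_gen hk) (one_le_of_mem_gen hl)
          hlk.symm hp]
      simp_rw [← sq]
      exact hK k (one_le_of_mem_gen hk)
    refine (mul_le_mul_of_nonneg_left h2 (by positivity)).trans (le_of_eq ?_)
    rw [Finset.sum_const, card_gen, nsmul_eq_mul]
    push_cast
    rw [show (4 : ℝ) = 2 * 2 by norm_num, mul_pow, one_div, inv_pow]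
    field_simp
  have hK2 : Summable fun n : ℕ => K * ((1 : ℝ) / 2) ^ n :=
    (summable_geometric_of_lt_one (by norm_num) (by norm_num)).mul_left K
  filter_upwards [ae_tendsto_zero_of_summable_integral hint (fun n ω => sq_nonneg _)
    (hK2.of_nonneg_of_le (fun n => integral_nonneg fun ω => sq_nonneg _) hle)] with ω hω
  have h := hω.sqrt
  simp only [Real.sqrt_sq_eq_abs, Real.sqrt_zero] at h
  exact (tendsto_zero_iff_abs_tendsto_zero _).2 h

/-- The averages of the `p`-th powers over the generations converge to the fixed point of the
moment recursion. -/
theorem ae_tendsto_gen_average (hX : IsRCBAR μ aₙ bₙ ε X a b c d) (h1 : H1 μ aₙ bₙ ε)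
    {t : ℕ → ℝ} (ht0 : t 0 = 1)
    (ht : ∀ p, 1 ≤ p → p ≤ 8 →
      2 * t p = ∑ i, ∑ j ∈ Finset.range (p + 1), momentCoef μ aₙ bₙ ε i p j * t j)
    {p : ℕ} (hp : p ≤ 8) :
    ∀ᵐ ω ∂μ, Tendsto (fun n => ((2 : ℝ) ^ n)⁻¹ * ∑ k ∈ gen n, X k ω ^ p) atTop (𝓝 (t p)) := by
  induction p using Nat.strong_induction_on with
  | _ p ih =>
    rcases Nat.eq_zero_or_pos p with rfl | hp0
    · refine Eventually.of_forall fun ω => tendsto_const_nhds.congr fun n => ?_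
      simp [card_gen, ht0]
    have ih' : ∀ᵐ ω ∂μ, ∀ j ∈ Finset.range p,
        Tendsto (fun n => ((2 : ℝ) ^ n)⁻¹ * ∑ k ∈ gen n, X k ω ^ j) atTop (𝓝 (t j)) :=
      (Finset.eventually_all _).2 fun j hj =>
        ih j (Finset.mem_range.1 hj) ((Finset.mem_range.1 hj).le.trans hp)
    have hpp : ∀ i, momentCoef μ aₙ bₙ ε i p p = coefMoment μ aₙ bₙ i p := fun i => by
      simp [momentCoef, noiseMoment]
    filter_upwards [ih', hX.ae_tendsto_fluct_average h1 hp] with ω hω hfl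
    -- The forcing term of the recursion: the fluctuation average vanishes and the powers below `p`
    -- converge by induction. The top term `j = p` supplies the ratio; the `2⁻¹` comes from the
    -- doubling of the generation.
    have hlim : Tendsto (fun n => 2⁻¹ * (((2 : ℝ) ^ n)⁻¹ * ∑ k ∈ gen n, fluct μ aₙ bₙ ε X p k ω +
        ∑ i, ∑ j ∈ Finset.range p, momentCoef μ aₙ bₙ ε i p j *
          (((2 : ℝ) ^ n)⁻¹ * ∑ k ∈ gen n, X k ω ^ j))) atTop
        (𝓝 (2⁻¹ * (0 + ∑ i, ∑ j ∈ Finset.range p, momentCoef μ aₙ bₙ ε i p j * t j))) :=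
      (hfl.add (tendsto_finsetSum _ fun i _ => tendsto_finsetSum _ fun j hj =>
        (hω j hj).const_mul _)).const_mul _
    refine tendsto_of_affine_recursion
      (r := (coefMoment μ aₙ bₙ 0 p + coefMoment μ aₙ bₙ 1 p) / 2) ?_ (fun n => ?_) hlim ?_
    · have h0 := abs_lt.1 (h1.abs_coefMoment_lt_one 0 hp0 (hp.trans (by norm_num)))
      have h1 := abs_lt.1 (h1.abs_coefMoment_lt_one 1 hp0 (hp.trans (by norm_num)))
      rw [abs_lt]
      constructor <;> linarith
    · have e : ∑ k ∈ gen n, ∑ i : Fin 2, X (2 * k + i) ω ^ p =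
          ∑ k ∈ gen n, fluct μ aₙ bₙ ε X p k ω +
            ∑ i, ∑ j ∈ Finset.range (p + 1), momentCoef μ aₙ bₙ ε i p j *
              ∑ k ∈ gen n, X k ω ^ j := by
        simp_rw [Finset.mul_sum]
        have hcomm : ∀ i : Fin 2, ∑ j ∈ Finset.range (p + 1), ∑ k ∈ gen n,
            momentCoef μ aₙ bₙ ε i p j * X k ω ^ j =
            ∑ k ∈ gen n, momentPoly μ aₙ bₙ ε i p (X k ω) := fun i => Finset.sum_comm
        rw [Finset.sum_congr rfl fun i _ => hcomm i, Finset.sum_comm (t := gen n),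
          ← Finset.sum_add_distrib]
        refine Finset.sum_congr rfl fun k _ => ?_
        rw [fluct, sub_add_cancel]
      rw [sum_gen_succ (fun k => X k ω ^ p), e, pow_succ, mul_inv]
      simp_rw [Finset.sum_range_succ _ p, Finset.sum_add_distrib, Fin.sum_univ_two, hpp, mul_add,
        Finset.mul_sum, mul_left_comm _ (((2 : ℝ) ^ n)⁻¹) _, ← Finset.mul_sum]
      ring
    · have h := ht p hp0 hp
      simp_rw [Finset.sum_range_succ _ p, hpp, Fin.sum_univ_two] at h
      rw [Fin.sum_univ_two]
      linarith

theorem ae_tendsto_tree_average (hX : IsRCBAR μ aₙ bₙ ε X a b c d) (h1 : H1 μ aₙ bₙ ε)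
    {t : ℕ → ℝ} (ht0 : t 0 = 1)
    (ht : ∀ p, 1 ≤ p → p ≤ 8 →
      2 * t p = ∑ i, ∑ j ∈ Finset.range (p + 1), momentCoef μ aₙ bₙ ε i p j * t j)
    {p : ℕ} (hp : p ≤ 8) :
    ∀ᵐ ω ∂μ, Tendsto (fun n => ((tree n).card : ℝ)⁻¹ *
      ∑ j ∈ Finset.range (n + 1), ∑ k ∈ gen j, X k ω ^ p) atTop (𝓝 (t p)) := by
  filter_upwards [hX.ae_tendsto_gen_average h1 ht0 ht hp] with ω hω
  exact tendsto_tree_average hω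

end IsRCBAR

end Model

/-! ### Positivity of symmetric two by two matrices. -/

section Matrix

theorem quadForm_nonneg {x y z : ℝ} (hx : 0 ≤ x) (hz : 0 ≤ z) (h : y ^ 2 ≤ x * z) (u v : ℝ) :
    0 ≤ x * u ^ 2 + 2 * y * u * v + z * v ^ 2 := by
  rcases hx.eq_or_lt with rfl | hx
  · have hy : y = 0 := by
      rw [zero_mul] at h
      exact pow_eq_zero_iff two_ne_zero |>.1 (le_antisymm h (sq_nonneg y))
    rw [hy]
    have := mul_nonneg hz (sq_nonneg v)
    linarith
  · refine nonneg_of_mul_nonneg_right (a := x) ?_ hx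
    have e : x * (x * u ^ 2 + 2 * y * u * v + z * v ^ 2) =
        (x * u + y * v) ^ 2 + (x * z - y ^ 2) * v ^ 2 := by ring
    rw [e]
    exact add_nonneg (sq_nonneg _) (mul_nonneg (sub_nonneg.2 h) (sq_nonneg v))

theorem posSemidef_two {x y z : ℝ}
    (h : ∀ u v : ℝ, 0 ≤ x * u ^ 2 + 2 * y * u * v + z * v ^ 2) :
    (!![x, y; y, z] : Matrix (Fin 2) (Fin 2) ℝ).PosSemidef := by
  refine Matrix.PosSemidef.of_dotProduct_mulVec_nonneg ?_ fun w => ?_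
  · ext i j
    fin_cases i <;> fin_cases j <;> rfl
  · have := h (w 0) (w 1)
    simp only [Matrix.mulVec, dotProduct, Fin.sum_univ_two, Matrix.of_apply, Matrix.cons_val_zero,
      Matrix.cons_val_one, Pi.star_apply, star_trivial]
    linarith

theorem posDef_two {x y z : ℝ} (hz : 0 < z) (h : y ^ 2 < x * z) :
    (!![x, y; y, z] : Matrix (Fin 2) (Fin 2) ℝ).PosDef := by
  refine Matrix.PosDef.of_dotProduct_mulVec_pos ?_ fun w hw => ?_
  · ext i j
    fin_cases i <;> fin_cases j <;> rfl
  · simp only [Matrix.mulVec, dotProduct, Fin.sum_univ_two, Matrix.of_apply, Matrix.cons_val_zero,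
      Matrix.cons_val_one, Pi.star_apply, star_trivial]
    -- Multiplying by `z`, the entry known to be positive, completes the square in `w 1`.
    refine pos_of_mul_pos_right (a := z) ?_ hz.le
    have e : z * (w 0 * (x * w 0 + y * w 1) + w 1 * (y * w 0 + z * w 1)) =
        (z * w 1 + y * w 0) ^ 2 + (x * z - y ^ 2) * w 0 ^ 2 := by ring
    rw [e]
    by_cases h0 : w 0 = 0
    · have h1 : w 1 ≠ 0 := fun h1 => hw (by ext i; fin_cases i <;> simp [h0, h1])
      rw [h0]
      have : 0 < (z * w 1) ^ 2 := by positivity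
      simpa using this
    · have : 0 < (x * z - y ^ 2) * w 0 ^ 2 := mul_pos (sub_pos.2 h) (by positivity)
      nlinarith [sq_nonneg (z * w 1 + y * w 0)]

end Matrix

/-! ### Constants recovered from conditional moments. -/

section General

variable {Ω : Type*} {mΩ : MeasurableSpace Ω} {μ : Measure Ω} [IsProbabilityMeasure μ]

theorem integral_eq_of_condExp_eq_const {m : MeasurableSpace Ω} (hm : m ≤ mΩ) {f : Ω → ℝ} {x : ℝ}
    (h : μ[f | m] =ᵐ[μ] fun _ => x) : ∫ ω, f ω ∂μ = x := by
  rw [← integral_condExp hm, integral_congr_ae h]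
  simp

/-- As the conditional mean is the constant `x`, the conditional variance is that of the deviation
from `x`, and integrating it gives the ordinary variance. -/
theorem integral_sq_of_condVar_eq_const {m : MeasurableSpace Ω} (hm : m ≤ mΩ) {f : Ω → ℝ} {x v : ℝ}
    (h : μ[f | m] =ᵐ[μ] fun _ => x) (hv : condVar m f μ =ᵐ[μ] fun _ => v) :
    ∫ ω, (f ω - x) * (f ω - x) ∂μ = v := by
  rw [← integral_eq_of_condExp_eq_const hm hv]
  refine integral_congr_ae ?_
  filter_upwards [h] with ω hω
  simp [hω, sq]

theorem integral_sub_mean_mul_self {f : Ω → ℝ} {x : ℝ} (hf : Integrable f μ)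
    (hf2 : Integrable (fun ω => f ω ^ 2) μ) (hx : ∫ ω, f ω ∂μ = x) :
    ∫ ω, (f ω - x) * (f ω - x) ∂μ = ∫ ω, f ω ^ 2 ∂μ - x ^ 2 := by
  have e : ∀ ω, (f ω - x) * (f ω - x) = f ω ^ 2 - 2 * x * f ω + x ^ 2 := fun ω => by ring
  have h1 : Integrable (fun ω => 2 * x * f ω) μ := hf.const_mul _
  have h2 : Integrable (fun ω => f ω ^ 2 - 2 * x * f ω) μ := hf2.sub h1
  simp_rw [e]
  rw [integral_add h2 (integrable_const _), integral_sub hf2 h1, integral_const_mul, hx,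
    integral_const]
  simp only [probReal_univ, smul_eq_mul, one_mul]
  ring

end General

/-! ### Moment recursion and positive definiteness of the limit. -/

section Model

variable {Ω : Type*} [mΩ : MeasurableSpace Ω] {μ : Measure Ω} {aₙ bₙ ε X : ℕ → Ω → ℝ}
  {a b c d σa σb σc σd ρab ρcd : ℝ}

/-- The limits of the averages of the `p`-th powers. -/
noncomputable def limitMoment (μ : Measure Ω) (aₙ bₙ ε : ℕ → Ω → ℝ) (p : ℕ) : ℝ :=
  -- The value at 0 needs care: under a probability measure the formula for `s` at `p = 0` divides
  -- by zero and returns 0, whereas the average of `X ^ 0` is 1.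
  if p = 0 then 1 else s μ aₙ bₙ ε p

theorem IsRCBAR.genSigma_le (hX : IsRCBAR μ aₙ bₙ ε X a b c d) (n : ℕ) : genSigma X n ≤ mΩ :=
  (genFiltration X hX.measurable_X).le n

variable [IsProbabilityMeasure μ]

/-- This is the definition of `s` cleared of the denominator `2 - (A_p + B_p)`, which is positive by
(H.1). The term `j = p` carries the denominator, and `j = 0` gives `C_p + D_p`. -/
theorem two_mul_limitMoment (h1 : H1 μ aₙ bₙ ε) {p : ℕ} (hp0 : 1 ≤ p) (hp : p ≤ 8) :
    2 * limitMoment μ aₙ bₙ ε p = ∑ i, ∑ j ∈ Finset.range (p + 1),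
      momentCoef μ aₙ bₙ ε i p j * limitMoment μ aₙ bₙ ε j := by
  have hA := abs_lt.1 (h1.abs_coefMoment_lt_one 0 hp0 (hp.trans (by norm_num)))
  have hB := abs_lt.1 (h1.abs_coefMoment_lt_one 1 hp0 (hp.trans (by norm_num)))
  have hs : limitMoment μ aₙ bₙ ε p =
      2 / (2 - (coefMoment μ aₙ bₙ 0 p + coefMoment μ aₙ bₙ 1 p)) *
      ((∑ k ∈ Finset.range p, if k = 0 then 0 else
        1 / 2 * (p.choose k : ℝ) *
          (coefMoment μ aₙ bₙ 0 k * noiseMoment μ ε 0 (p - k) +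
            coefMoment μ aₙ bₙ 1 k * noiseMoment μ ε 1 (p - k)) * s μ aₙ bₙ ε k) +
      (noiseMoment μ ε 0 p + noiseMoment μ ε 1 p) / 2) := by
    rw [limitMoment, if_neg (by omega), s, ← Fin.sum_univ_eq_sum_range]
    rfl
  have hpp : ∀ i, momentCoef μ aₙ bₙ ε i p p = coefMoment μ aₙ bₙ i p := fun i => by
    simp [momentCoef, noiseMoment]
  obtain ⟨q, rfl⟩ : ∃ q, p = q + 1 := ⟨p - 1, by omega⟩
  have hp0' : ∀ i, momentCoef μ aₙ bₙ ε i (q + 1) 0 = noiseMoment μ ε i (q + 1) := fun i => by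
    simp [momentCoef, coefMoment]
  have hl0 : limitMoment μ aₙ bₙ ε 0 = 1 := if_pos rfl
  have hlk : ∀ k, limitMoment μ aₙ bₙ ε (k + 1) = s μ aₙ bₙ ε (k + 1) := fun k =>
    if_neg (Nat.succ_ne_zero k)
  rw [Finset.sum_range_succ'] at hs
  simp only [Nat.succ_ne_zero, if_false, if_true, add_zero] at hs
  rw [Fin.sum_univ_two]
  simp_rw [Finset.sum_range_succ _ (q + 1), hpp, Finset.sum_range_succ' _ q, hp0', hl0, mul_one]
  have hsum : ∑ k ∈ Finset.range q, momentCoef μ aₙ bₙ ε 0 (q + 1) (k + 1) *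
        limitMoment μ aₙ bₙ ε (k + 1) + ∑ k ∈ Finset.range q,
        momentCoef μ aₙ bₙ ε 1 (q + 1) (k + 1) * limitMoment μ aₙ bₙ ε (k + 1) =
      2 * ∑ k ∈ Finset.range q, 1 / 2 * ((q + 1).choose (k + 1) : ℝ) *
          (coefMoment μ aₙ bₙ 0 (k + 1) * noiseMoment μ ε 0 (q + 1 - (k + 1)) +
            coefMoment μ aₙ bₙ 1 (k + 1) * noiseMoment μ ε 1 (q + 1 - (k + 1))) *
          s μ aₙ bₙ ε (k + 1) := by
    rw [← Finset.sum_add_distrib, Finset.mul_sum]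
    refine Finset.sum_congr rfl fun k _ => ?_
    rw [hlk, momentCoef, momentCoef]
    ring
  have hne : 2 - (coefMoment μ aₙ bₙ 0 (q + 1) + coefMoment μ aₙ bₙ 1 (q + 1)) ≠ 0 := by
    linarith
  rw [div_mul_eq_mul_div, eq_div_iff hne] at hs
  linarith

/-- The covariance matrix of the random coefficients. -/
noncomputable def coefCov (μ : Measure Ω) (aₙ bₙ : ℕ → Ω → ℝ) (i j : Fin 2) : ℝ :=
  ∫ ω, (coef aₙ bₙ i 1 ω - coefMoment μ aₙ bₙ i 1) *
    (coef aₙ bₙ j 1 ω - coefMoment μ aₙ bₙ j 1) ∂μ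

/-- The covariance matrix of the environmental effects. -/
noncomputable def noiseCov (μ : Measure Ω) (ε : ℕ → Ω → ℝ) (i j : Fin 2) : ℝ :=
  ∫ ω, (ε (2 * 1 + i) ω - noiseMoment μ ε i 1) * (ε (2 * 1 + j) ω - noiseMoment μ ε j 1) ∂μ

theorem one_mem_gen_zero : 1 ∈ gen 0 := by simp [gen]

namespace IsRCBAR

theorem coefMoment_zero_one (hX : IsRCBAR μ aₙ bₙ ε X a b c d) : coefMoment μ aₙ bₙ 0 1 = a := by
  rw [← integral_eq_of_condExp_eq_const (hX.genSigma_le 0) (hX.condExp_a 0 1 one_mem_gen_zero)]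
  simp [coefMoment, coef]

theorem coefMoment_one_one (hX : IsRCBAR μ aₙ bₙ ε X a b c d) : coefMoment μ aₙ bₙ 1 1 = b := by
  rw [← integral_eq_of_condExp_eq_const (hX.genSigma_le 0) (hX.condExp_b 0 1 one_mem_gen_zero)]
  simp [coefMoment, coef]

theorem noiseMoment_zero_one (hX : IsRCBAR μ aₙ bₙ ε X a b c d) : noiseMoment μ ε 0 1 = c := by
  rw [← integral_eq_of_condExp_eq_const (hX.genSigma_le 0)
    (hX.condExp_ε_even 0 1 one_mem_gen_zero)]
  simp [noiseMoment]

theorem noiseMoment_one_one (hX : IsRCBAR μ aₙ bₙ ε X a b c d) : noiseMoment μ ε 1 1 = d := by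
  rw [← integral_eq_of_condExp_eq_const (hX.genSigma_le 0)
    (hX.condExp_ε_odd 0 1 one_mem_gen_zero)]
  simp [noiseMoment]

/-- The conditional variances and covariance at the root are constant, so integrating them
identifies the ordinary ones. -/
theorem coefCov_eq (hX : IsRCBAR μ aₙ bₙ ε X a b c d) (h2 : H2 μ aₙ bₙ ε X σa σb σc σd)
    (h3 : H3 μ aₙ bₙ ε X a b c d σa σb σc σd ρab ρcd) (i j : Fin 2) :
    coefCov μ aₙ bₙ i j = !![σa ^ 2, ρab; ρab, σb ^ 2] i j := by
  have hm := hX.genSigma_le 0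
  have h01 : coefCov μ aₙ bₙ 0 1 = ρab := by
    rw [coefCov, hX.coefMoment_zero_one, hX.coefMoment_one_one]
    exact integral_eq_of_condExp_eq_const hm (h3.cov_ab 0 1 one_mem_gen_zero)
  fin_cases i <;> fin_cases j
  · change coefCov μ aₙ bₙ 0 0 = σa ^ 2
    rw [coefCov, hX.coefMoment_zero_one]
    exact integral_sq_of_condVar_eq_const hm (hX.condExp_a 0 1 one_mem_gen_zero)
      (h2.var_a 0 1 one_mem_gen_zero)
  · exact h01
  · refine Eq.trans ?_ h01
    simp only [coefCov]
    exact integral_congr_ae (Eventually.of_forall fun ω => mul_comm _ _)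
  · change coefCov μ aₙ bₙ 1 1 = σb ^ 2
    rw [coefCov, hX.coefMoment_one_one]
    exact integral_sq_of_condVar_eq_const hm (hX.condExp_b 0 1 one_mem_gen_zero)
      (h2.var_b 0 1 one_mem_gen_zero)

theorem noiseCov_eq (hX : IsRCBAR μ aₙ bₙ ε X a b c d) (h2 : H2 μ aₙ bₙ ε X σa σb σc σd)
    (h3 : H3 μ aₙ bₙ ε X a b c d σa σb σc σd ρab ρcd) (i j : Fin 2) :
    noiseCov μ ε i j = !![σc ^ 2, ρcd; ρcd, σd ^ 2] i j := by
  have hm := hX.genSigma_le 0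
  have h01 : noiseCov μ ε 0 1 = ρcd := by
    rw [noiseCov, hX.noiseMoment_zero_one, hX.noiseMoment_one_one]
    exact integral_eq_of_condExp_eq_const hm (h3.cov_ε 0 1 one_mem_gen_zero)
  fin_cases i <;> fin_cases j
  · change noiseCov μ ε 0 0 = σc ^ 2
    rw [noiseCov, hX.noiseMoment_zero_one]
    exact integral_sq_of_condVar_eq_const hm (hX.condExp_ε_even 0 1 one_mem_gen_zero)
      (h2.var_ε_even 0 1 one_mem_gen_zero)
  · exact h01
  · refine Eq.trans ?_ h01
    simp only [noiseCov]
    exact integral_congr_ae (Eventually.of_forall fun ω => mul_comm _ _)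
  · change noiseCov μ ε 1 1 = σd ^ 2
    rw [noiseCov, hX.noiseMoment_one_one]
    exact integral_sq_of_condVar_eq_const hm (hX.condExp_ε_odd 0 1 one_mem_gen_zero)
      (h2.var_ε_odd 0 1 one_mem_gen_zero)

theorem coefMoment_two (hX : IsRCBAR μ aₙ bₙ ε X a b c d) (h1 : H1 μ aₙ bₙ ε) (i : Fin 2) :
    coefMoment μ aₙ bₙ i 2 = coefCov μ aₙ bₙ i i + coefMoment μ aₙ bₙ i 1 ^ 2 := by
  have hi1 : Integrable (fun ω => coef aₙ bₙ i 1 ω) μ := by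
    simpa using hX.integrable_coef_pow h1 i le_rfl (p := 1) (by norm_num)
  have hi2 := hX.integrable_coef_pow h1 i le_rfl (p := 2) (by norm_num)
  have hm : ∫ ω, coef aₙ bₙ i 1 ω ∂μ = coefMoment μ aₙ bₙ i 1 := by simp [coefMoment]
  rw [coefCov, integral_sub_mean_mul_self hi1 hi2 hm, coefMoment]
  ring

theorem noiseMoment_two (hX : IsRCBAR μ aₙ bₙ ε X a b c d) (h1 : H1 μ aₙ bₙ ε) (i : Fin 2) :
    noiseMoment μ ε i 2 = noiseCov μ ε i i + noiseMoment μ ε i 1 ^ 2 := by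
  have hi1 : Integrable (fun ω => ε (2 * 1 + i) ω) μ := by
    simpa only [pow_one] using hX.integrable_noise_pow h1 i le_rfl (p := 1) (by norm_num)
  have hi2 := hX.integrable_noise_pow h1 i le_rfl (p := 2) (by norm_num)
  have hm : ∫ ω, ε (2 * 1 + i) ω ∂μ = noiseMoment μ ε i 1 := by simp only [noiseMoment, pow_one]
  rw [noiseCov, integral_sub_mean_mul_self hi1 hi2 hm, noiseMoment]
  ring

theorem posDef_C (hX : IsRCBAR μ aₙ bₙ ε X a b c d) (h1 : H1 μ aₙ bₙ ε)
    (h2 : H2 μ aₙ bₙ ε X σa σb σc σd) (h3 : H3 μ aₙ bₙ ε X a b c d σa σb σc σd ρab ρcd) :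
    (C μ aₙ bₙ ε).PosDef := by
  refine posDef_two one_pos ?_
  rw [mul_one]
  have e1 := two_mul_limitMoment h1 (p := 1) le_rfl (by norm_num)
  have e2 := two_mul_limitMoment h1 (p := 2) (by norm_num) (by norm_num)
  have hA := abs_lt.1 (h1.abs_coefMoment_lt_one 0 (p := 2) (by norm_num) (by norm_num))
  have hB := abs_lt.1 (h1.abs_coefMoment_lt_one 1 (p := 2) (by norm_num) (by norm_num))
  have c0 : ∀ i, coefMoment μ aₙ bₙ i 0 = 1 := fun i => by simp [coefMoment]
  have n0 : ∀ i, noiseMoment μ ε i 0 = 1 := fun i => by simp [noiseMoment]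
  have hl0 : limitMoment μ aₙ bₙ ε 0 = 1 := if_pos rfl
  have hl1 : limitMoment μ aₙ bₙ ε 1 = s μ aₙ bₙ ε 1 := if_neg one_ne_zero
  have hl2 : limitMoment μ aₙ bₙ ε 2 = s μ aₙ bₙ ε 2 := if_neg two_ne_zero
  simp only [Fin.sum_univ_two, Finset.sum_range_succ, Finset.sum_range_zero, momentCoef, hl0, hl1,
    hl2, c0, n0, Nat.choose_self, Nat.choose_zero_right, Nat.cast_one, mul_one, one_mul, zero_add,
    Nat.sub_self, Nat.sub_zero, Nat.choose_one_right, Nat.cast_ofNat,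
    show 2 - 1 = 1 from rfl] at e1 e2
  have va : coefCov μ aₙ bₙ 0 0 = σa ^ 2 := hX.coefCov_eq h2 h3 0 0
  have vb : coefCov μ aₙ bₙ 1 1 = σb ^ 2 := hX.coefCov_eq h2 h3 1 1
  have vc : noiseCov μ ε 0 0 = σc ^ 2 := hX.noiseCov_eq h2 h3 0 0
  have vd : noiseCov μ ε 1 1 = σd ^ 2 := hX.noiseCov_eq h2 h3 1 1
  have a2 := hX.coefMoment_two h1 0
  have b2 := hX.coefMoment_two h1 1
  have c2 := hX.noiseMoment_two h1 0
  have d2 := hX.noiseMoment_two h1 1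
  rw [va] at a2
  rw [vb] at b2
  rw [vc] at c2
  rw [vd] at d2
  have pc := h2.pos_c
  have pd := h2.pos_d
  generalize s μ aₙ bₙ ε 1 = s₁ at *
  generalize s μ aₙ bₙ ε 2 = s₂ at *
  generalize coefMoment μ aₙ bₙ 0 1 = A₁ at *
  generalize coefMoment μ aₙ bₙ 1 1 = B₁ at *
  generalize noiseMoment μ ε 0 1 = C₁ at *
  generalize noiseMoment μ ε 1 1 = D₁ at *
  generalize coefMoment μ aₙ bₙ 0 2 = A₂ at *
  generalize coefMoment μ aₙ bₙ 1 2 = B₂ at *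
  generalize noiseMoment μ ε 0 2 = C₂ at *
  generalize noiseMoment μ ε 1 2 = D₂ at *
  -- A variance decomposition for the mixture of the two daughter types: coefficient variances,
  -- noise variances, and the spread between the two mean maps at `s₁`. The noise variances make it
  -- strictly positive.
  have key : (2 - (A₂ + B₂)) * (s₂ - s₁ ^ 2) = σa ^ 2 * s₁ ^ 2 + σb ^ 2 * s₁ ^ 2 + σc ^ 2 + σd ^ 2 +
      ((A₁ * s₁ + C₁) - (B₁ * s₁ + D₁)) ^ 2 / 2 := by
    have e3 : (A₁ * s₁ + C₁) + (B₁ * s₁ + D₁) = 2 * s₁ := by linarith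
    have e4 : ((A₁ * s₁ + C₁) - (B₁ * s₁ + D₁)) ^ 2 / 2 =
        (A₁ * s₁ + C₁) ^ 2 + (B₁ * s₁ + D₁) ^ 2 - (2 * s₁) ^ 2 / 2 := by
      rw [← e3]; ring
    rw [e4]
    have e5 : (2 - (A₂ + B₂)) * s₂ =
        2 * (A₁ * C₁ + B₁ * D₁) * s₁ + C₂ + D₂ := by linarith
    rw [mul_sub, e5, a2, b2, c2, d2]
    ring
  have hpos : 0 < (2 - (A₂ + B₂)) * (s₂ - s₁ ^ 2) := by
    rw [key]
    positivity
  exact sub_pos.1 (pos_of_mul_pos_right hpos (by linarith))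

/-- Along a sample path, the quadratic form is the limit of the generation averages of `(X ^ 2 * u +
X * v) ^ 2`. -/
theorem posSemidef_D (hX : IsRCBAR μ aₙ bₙ ε X a b c d) (h1 : H1 μ aₙ bₙ ε) :
    (D μ aₙ bₙ ε).PosSemidef := by
  refine posSemidef_two fun u v => ?_
  have h := fun (p : ℕ) (hp : p ≤ 8) =>
    hX.ae_tendsto_gen_average h1 (t := limitMoment μ aₙ bₙ ε) (if_pos rfl)
      (fun p hp0 hp => two_mul_limitMoment h1 hp0 hp) hp
  -- Almost sure convergence under a probability measure provides at least one path on which all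
  -- three limits hold.
  obtain ⟨ω, h2, h3, h4⟩ :=
    ((h 2 (by norm_num)).and ((h 3 (by norm_num)).and (h 4 (by norm_num)))).exists
  have hlim := ((h4.mul_const (u ^ 2)).add (h3.mul_const (2 * u * v))).add (h2.mul_const (v ^ 2))
  have e : limitMoment μ aₙ bₙ ε 4 * u ^ 2 + limitMoment μ aₙ bₙ ε 3 * (2 * u * v) +
      limitMoment μ aₙ bₙ ε 2 * v ^ 2 = s μ aₙ bₙ ε 4 * u ^ 2 + 2 * s μ aₙ bₙ ε 3 * u * v +
      s μ aₙ bₙ ε 2 * v ^ 2 := by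
    simp only [limitMoment, OfNat.ofNat_ne_zero, if_false]
    ring
  rw [e] at hlim
  refine ge_of_tendsto' hlim fun n => ?_
  have e' : ((2 : ℝ) ^ n)⁻¹ * (∑ k ∈ gen n, X k ω ^ 4) * u ^ 2 +
      ((2 : ℝ) ^ n)⁻¹ * (∑ k ∈ gen n, X k ω ^ 3) * (2 * u * v) +
      ((2 : ℝ) ^ n)⁻¹ * (∑ k ∈ gen n, X k ω ^ 2) * v ^ 2 =
      ((2 : ℝ) ^ n)⁻¹ * ∑ k ∈ gen n, (X k ω ^ 2 * u + X k ω * v) ^ 2 := by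
    simp only [mul_assoc, Finset.sum_mul]
    rw [← mul_add, ← mul_add, ← Finset.sum_add_distrib, ← Finset.sum_add_distrib]
    congr 1
    exact Finset.sum_congr rfl fun k _ => by ring
  rw [e']
  positivity

/-- The noise term is a Kronecker product of positive definite matrices; the coefficient term only
needs to be semidefinite. -/
theorem posDef_L (hX : IsRCBAR μ aₙ bₙ ε X a b c d) (h1 : H1 μ aₙ bₙ ε)
    (h2 : H2 μ aₙ bₙ ε X σa σb σc σd) (h3 : H3 μ aₙ bₙ ε X a b c d σa σb σc σd ρab ρcd) :
    (L μ aₙ bₙ ε σa σb σc σd ρab ρcd).PosDef :=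
  ((posDef_two h2.pos_d h3.lt_cd).kronecker (hX.posDef_C h1 h2 h3)).add_posSemidef
    ((posSemidef_two (quadForm_nonneg (sq_nonneg _) (sq_nonneg _) h3.le_ab)).kronecker
      (hX.posSemidef_D h1))

end IsRCBAR

end Model

/-! ### Square integrability of products and the tower property. -/

section General

variable {Ω : Type*} {mΩ : MeasurableSpace Ω} {μ : Measure Ω}

/-- Independence makes the product of the squares integrable, so no fourth moments are needed. -/
theorem memLp_mul_of_indep {m₁ m₂ : MeasurableSpace Ω} (h : Indep m₁ m₂ μ) {f g : Ω → ℝ}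
    (hf : Measurable[m₁] f) (hg : Measurable[m₂] g) (hf2 : MemLp f 2 μ) (hg2 : MemLp g 2 μ) :
    MemLp (fun ω => f ω * g ω) 2 μ := by
  refine (memLp_two_iff_integrable_sq (hf2.1.mul hg2.1)).2 ?_
  refine (integrable_mul_of_indep h (hf.pow_const 2) (hg.pow_const 2) hf2.integrable_sq
    hg2.integrable_sq).congr (Eventually.of_forall fun ω => ?_)
  simp [mul_pow]

/-- Tower property for a conditional expectation that is measurable for a smaller σ-algebra. -/
theorem condExp_eq_of_condExp_eq [IsFiniteMeasure μ] {m m' : MeasurableSpace Ω} (hm' : m' ≤ m)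
    (hm : m ≤ mΩ) {f g : Ω → ℝ} (h : μ[f | m] =ᵐ[μ] g) (hg : Measurable[m'] g) :
    μ[f | m'] =ᵐ[μ] g := by
  have hgi : Integrable g μ := integrable_condExp.congr h
  refine (condExp_condExp_of_le hm' hm).symm.trans ((condExp_congr_ae h).trans ?_)
  rw [condExp_of_stronglyMeasurable (hm'.trans hm) hg.stronglyMeasurable hgi]

end General

/-! ### The martingale and its increasing process. -/

section Model

variable {Ω : Type*} {aₙ bₙ ε X : ℕ → Ω → ℝ}

theorem mem_tree_of_mem_gen {k j n : ℕ} (hk : k ∈ gen j) (hj : j ≤ n) : k ∈ tree n :=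
  Finset.mem_biUnion.2 ⟨j, Finset.mem_range.2 (Nat.lt_succ_of_le hj), hk⟩

theorem daughter_mem_gen {k n : ℕ} (hk : k ∈ gen n) (i : Fin 2) : 2 * k + i ∈ gen (n + 1) := by
  have h := Finset.mem_Ico.1 hk
  refine Finset.mem_Ico.2 ?_
  have hi := i.2
  rw [pow_succ 2 (n + 1), pow_succ 2 n] at *
  omega

theorem log_daughter {k n : ℕ} (hk : k ∈ gen n) (i : Fin 2) : Nat.log 2 (2 * k + i) - 1 = n := by
  have h := Finset.mem_Ico.1 (daughter_mem_gen hk i)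
  rw [Nat.log_eq_of_pow_le_of_lt_pow h.1 h.2, Nat.add_sub_cancel]

theorem measurable_X_genSigma {k n : ℕ} (hk : k ∈ tree n) : Measurable[genSigma X n] (X k) :=
  (comap_measurable (X k)).mono
    (le_biSup (f := fun k => MeasurableSpace.comap (X k) inferInstance) hk) le_rfl

variable [mΩ : MeasurableSpace Ω] {μ : Measure Ω} {a b c d σa σb σc σd ρab ρcd : ℝ}

/-- The centered random coefficient of the `i`-th daughter of `k`. -/
noncomputable def coefDev (μ : Measure Ω) (aₙ bₙ : ℕ → Ω → ℝ) (i : Fin 2) (k : ℕ) (ω : Ω) : ℝ :=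
  coef aₙ bₙ i k ω - coefMoment μ aₙ bₙ i 1

/-- The centered environmental effect on the `i`-th daughter of `k`. -/
noncomputable def noiseDev (μ : Measure Ω) (ε : ℕ → Ω → ℝ) (i : Fin 2) (k : ℕ) (ω : Ω) : ℝ :=
  ε (2 * k + i) ω - noiseMoment μ ε i 1

/-- The contribution of the individual `k` to the martingale increment. -/
noncomputable def innov (μ : Measure Ω) (aₙ bₙ ε X : ℕ → Ω → ℝ) (i : Fin 2 × Fin 2) (k : ℕ)
    (ω : Ω) : ℝ :=
  -- The weight `![X k, 1] i.2` is written as the power `X k ^ (1 - i.2)`, so that all the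
  -- coordinates are treated at once.
  coefDev μ aₙ bₙ i.1 k ω * X k ω ^ ((1 - i.2 : ℕ) + 1) + noiseDev μ ε i.1 k ω * X k ω ^ (1 - i.2 : ℕ)

theorem measurable_coefDev_coefSigma (i : Fin 2) (k : ℕ) :
    Measurable[coefSigma aₙ bₙ k] (coefDev μ aₙ bₙ i k) :=
  (measurable_coef_coefSigma i k).sub_const _

theorem measurable_noiseDev_noiseSigma (i : Fin 2) (k : ℕ) :
    Measurable[noiseSigma ε k] (noiseDev μ ε i k) :=
  (measurable_noise_noiseSigma i k).sub_const _

theorem measurable_coefDev_effects (i : Fin 2) (k : ℕ) :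
    Measurable[coefSigma aₙ bₙ k ⊔ noiseSigma ε k] (coefDev μ aₙ bₙ i k) :=
  (measurable_coefDev_coefSigma i k).mono le_sup_left le_rfl

theorem measurable_noiseDev_effects (i : Fin 2) (k : ℕ) :
    Measurable[coefSigma aₙ bₙ k ⊔ noiseSigma ε k] (noiseDev μ ε i k) :=
  (measurable_noiseDev_noiseSigma i k).mono le_sup_right le_rfl

namespace IsRCBAR

theorem measurable_innov_othersSigma (hX : IsRCBAR μ aₙ bₙ ε X a b c d) (i : Fin 2 × Fin 2)
    {k l : ℕ} (hl : 1 ≤ l) (hlk : l < k) :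
    Measurable[othersSigma aₙ bₙ ε X k] (innov μ aₙ bₙ ε X i l) :=
  (((measurable_coefDev_coefSigma i.1 l).mono (coefSigma_le_othersSigma hl hlk.ne) le_rfl).mul
    ((hX.measurable_X_othersSigma hl (by omega)).pow_const _)).add
  (((measurable_noiseDev_noiseSigma i.1 l).mono (noiseSigma_le_othersSigma hl hlk.ne) le_rfl).mul
    ((hX.measurable_X_othersSigma hl (by omega)).pow_const _))

theorem integral_coefDev_mul (hX : IsRCBAR μ aₙ bₙ ε X a b c d) (i j : Fin 2) {k : ℕ}
    (hk : 1 ≤ k) : ∫ ω, coefDev μ aₙ bₙ i k ω * coefDev μ aₙ bₙ j k ω ∂μ = coefCov μ aₙ bₙ i j := by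
  have hm : ∀ i : Fin 2, Measurable fun x : ℝ × ℝ => ![x.1, x.2] i := fun i => by
    fin_cases i
    · exact measurable_fst
    · exact measurable_snd
  exact hX.integral_comp_coef hk (φ := fun x => (![x.1, x.2] i - coefMoment μ aₙ bₙ i 1) *
    (![x.1, x.2] j - coefMoment μ aₙ bₙ j 1)) (((hm i).sub_const _).mul ((hm j).sub_const _))

theorem integral_noiseDev_mul (hX : IsRCBAR μ aₙ bₙ ε X a b c d) (i j : Fin 2) {k : ℕ}
    (hk : 1 ≤ k) : ∫ ω, noiseDev μ ε i k ω * noiseDev μ ε j k ω ∂μ = noiseCov μ ε i j := by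
  have hm : ∀ i : Fin 2, Measurable fun x : ℝ × ℝ => ![x.1, x.2] i := fun i => by
    fin_cases i
    · exact measurable_fst
    · exact measurable_snd
  have hv : ∀ (i : Fin 2) (k : ℕ) (ω : Ω),
      ε (2 * k + i) ω = ![ε (2 * k) ω, ε (2 * k + 1) ω] i := fun i k ω => by
    fin_cases i <;> rfl
  simp only [noiseCov, noiseDev, hv]
  exact hX.integral_comp_noise hk (φ := fun x => (![x.1, x.2] i - noiseMoment μ ε i 1) *
    (![x.1, x.2] j - noiseMoment μ ε j 1)) (((hm i).sub_const _).mul ((hm j).sub_const _))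

theorem measurable_M_genSigma (n : ℕ) : Measurable[genSigma X n] (M μ X n) := by
  refine (@measurable_pi_iff _ _ _ (genSigma X n) _ _).2 fun i => Finset.measurable_fun_sum _ fun j hj =>
    Finset.measurable_fun_sum _ fun k hk => ?_
  have hj' : j < n := Finset.mem_range.1 hj
  have hXm : Measurable[genSigma X n] (X k) :=
    measurable_X_genSigma (mem_tree_of_mem_gen hk hj'.le)
  refine Measurable.mul ?_ (Measurable.sub
    (measurable_X_genSigma (mem_tree_of_mem_gen (daughter_mem_gen hk i.1) hj')) ?_)
  · have hw : ∀ j : Fin 2, Measurable[genSigma X n] fun ω => ![X k ω, 1] j := fun j => by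
      fin_cases j
      · exact hXm
      · exact measurable_const
    exact hw i.2
  · rw [log_daughter hk i.1]
    exact stronglyMeasurable_condExp.measurable.mono (genSigma_mono X hj'.le) le_rfl

variable [IsProbabilityMeasure μ]

theorem memLp_coefDev (hX : IsRCBAR μ aₙ bₙ ε X a b c d) (h1 : H1 μ aₙ bₙ ε) (i : Fin 2)
    {k : ℕ} (hk : 1 ≤ k) : MemLp (coefDev μ aₙ bₙ i k) 2 μ :=
  ((memLp_two_iff_integrable_sq (hX.measurable_coef i hk).aestronglyMeasurable).2
    (hX.integrable_coef_pow h1 i hk (by norm_num))).sub (memLp_const _)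

theorem memLp_noiseDev (hX : IsRCBAR μ aₙ bₙ ε X a b c d) (h1 : H1 μ aₙ bₙ ε) (i : Fin 2)
    {k : ℕ} (hk : 1 ≤ k) : MemLp (noiseDev μ ε i k) 2 μ :=
  ((memLp_two_iff_integrable_sq (hX.measurable_noise i hk).aestronglyMeasurable).2
    (hX.integrable_noise_pow h1 i hk (by norm_num))).sub (memLp_const _)

theorem integral_coefDev (hX : IsRCBAR μ aₙ bₙ ε X a b c d) (h1 : H1 μ aₙ bₙ ε) (i : Fin 2)
    {k : ℕ} (hk : 1 ≤ k) : ∫ ω, coefDev μ aₙ bₙ i k ω ∂μ = 0 := by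
  have h := hX.integral_coef_pow i hk 1
  have hi := hX.integrable_coef_pow h1 i hk (p := 1) (by norm_num)
  simp only [pow_one] at h hi
  simp only [coefDev]
  rw [integral_sub hi (integrable_const _), h]
  simp

theorem integral_noiseDev (hX : IsRCBAR μ aₙ bₙ ε X a b c d) (h1 : H1 μ aₙ bₙ ε) (i : Fin 2)
    {k : ℕ} (hk : 1 ≤ k) : ∫ ω, noiseDev μ ε i k ω ∂μ = 0 := by
  have h := hX.integral_noise_pow i hk 1
  have hi := hX.integrable_noise_pow h1 i hk (p := 1) (by norm_num)
  simp only [pow_one] at h hi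
  simp only [noiseDev]
  rw [integral_sub hi (integrable_const _), h]
  simp

theorem integral_coefDev_mul_noiseDev (hX : IsRCBAR μ aₙ bₙ ε X a b c d) (h1 : H1 μ aₙ bₙ ε)
    (i j : Fin 2) {k : ℕ} (hk : 1 ≤ k) :
    ∫ ω, coefDev μ aₙ bₙ i k ω * noiseDev μ ε j k ω ∂μ = 0 := by
  rw [integral_mul_of_indep (hX.coefSigma_le hk) (hX.noiseSigma_le hk)
    (hX.indep_coefSigma_noiseSigma hk) (measurable_coefDev_coefSigma i k)
    (measurable_noiseDev_noiseSigma j k), hX.integral_coefDev h1 i hk, zero_mul]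

/-- Conditional expectation of a quadratic polynomial in `X k`, up to the factor `X k ^ q`, whose
coefficients are functions of the effects on the daughters of `k`. -/
theorem condExp_effects_poly (hX : IsRCBAR μ aₙ bₙ ε X a b c d) (h1 : H1 μ aₙ bₙ ε)
    {k : ℕ} (hk : 1 ≤ k) {f g h : Ω → ℝ}
    (hf : Measurable[coefSigma aₙ bₙ k ⊔ noiseSigma ε k] f)
    (hg : Measurable[coefSigma aₙ bₙ k ⊔ noiseSigma ε k] g)
    (hh : Measurable[coefSigma aₙ bₙ k ⊔ noiseSigma ε k] h)
    (hfi : Integrable f μ) (hgi : Integrable g μ) (hhi : Integrable h μ) {q : ℕ} (hq : q + 2 ≤ 16) :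
    μ[fun ω => f ω * X k ω ^ (q + 2) + (g ω * X k ω ^ (q + 1) + h ω * X k ω ^ q) |
      othersSigma aₙ bₙ ε X k] =ᵐ[μ] fun ω => (∫ ω, f ω ∂μ) * X k ω ^ (q + 2) +
        ((∫ ω, g ω ∂μ) * X k ω ^ (q + 1) + (∫ ω, h ω ∂μ) * X k ω ^ q) := by
  have hXm := hX.measurable_X_othersSigma hk (show k < 2 * k by omega)
  have hind := hX.indep_othersSigma hk
  have hXi : ∀ p ≤ 16, Integrable (fun ω => X k ω ^ p) μ := fun p hp =>
    hX.integrable_X_pow h1 hk hp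
  have I : ∀ {u : Ω → ℝ} (p : ℕ), p ≤ 16 →
      Measurable[coefSigma aₙ bₙ k ⊔ noiseSigma ε k] u → Integrable u μ →
      Integrable (fun ω => u ω * X k ω ^ p) μ := fun p hp hu hui =>
    integrable_mul_of_indep hind hu (hXm.pow_const p) hui (hXi p hp)
  have E : ∀ {u : Ω → ℝ} (p : ℕ), p ≤ 16 →
      Measurable[coefSigma aₙ bₙ k ⊔ noiseSigma ε k] u → Integrable u μ →
      μ[fun ω => u ω * X k ω ^ p | othersSigma aₙ bₙ ε X k] =ᵐ[μ]
        fun ω => (∫ ω, u ω ∂μ) * X k ω ^ p := fun p hp hu hui =>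
    condExp_mul_of_indep_of_measurable (hX.effectsSigma_le hk) (hX.othersSigma_le k) le_rfl hind
      hu (hXm.pow_const p) hui (hXi p hp)
  have s1 := condExp_add (m := othersSigma aₙ bₙ ε X k) (I (q + 2) (by omega) hf hfi)
    ((I (q + 1) (by omega) hg hgi).add (I q (by omega) hh hhi))
  have s2 := condExp_add (m := othersSigma aₙ bₙ ε X k) (I (q + 1) (by omega) hg hgi)
    (I q (by omega) hh hhi)
  refine s1.trans ?_
  filter_upwards [s2, E (q + 2) (by omega) hf hfi, E (q + 1) (by omega) hg hgi,
    E q (by omega) hh hhi] with ω e2 e3 e4 e5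
  rw [Pi.add_apply, e2, Pi.add_apply, e3, e4, e5]

theorem memLp_innov (hX : IsRCBAR μ aₙ bₙ ε X a b c d) (h1 : H1 μ aₙ bₙ ε) (i : Fin 2 × Fin 2)
    {k : ℕ} (hk : 1 ≤ k) : MemLp (innov μ aₙ bₙ ε X i k) 2 μ := by
  have hXm := hX.measurable_X_othersSigma hk (show k < 2 * k by omega)
  have hind := hX.indep_othersSigma hk
  exact (memLp_mul_of_indep hind (measurable_coefDev_effects i.1 k) (hXm.pow_const _)
    (hX.memLp_coefDev h1 i.1 hk) (hX.memLp_X_pow h1 hk (by omega))).add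
    (memLp_mul_of_indep hind (measurable_noiseDev_effects i.1 k) (hXm.pow_const _)
      (hX.memLp_noiseDev h1 i.1 hk) (hX.memLp_X_pow h1 hk (by omega)))

theorem condExp_innov (hX : IsRCBAR μ aₙ bₙ ε X a b c d) (h1 : H1 μ aₙ bₙ ε) (i : Fin 2 × Fin 2)
    {k : ℕ} (hk : 1 ≤ k) :
    μ[innov μ aₙ bₙ ε X i k | othersSigma aₙ bₙ ε X k] =ᵐ[μ] 0 := by
  have h := hX.condExp_effects_poly h1 hk (f := fun _ => 0) (q := (1 - i.2 : ℕ)) measurable_const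
    (measurable_coefDev_effects i.1 k) (measurable_noiseDev_effects i.1 k) (integrable_const 0)
    ((hX.memLp_coefDev h1 i.1 hk).integrable one_le_two)
    ((hX.memLp_noiseDev h1 i.1 hk).integrable one_le_two) (by omega)
  simp only [zero_mul, zero_add, hX.integral_coefDev h1 i.1 hk, hX.integral_noiseDev h1 i.1 hk,
    integral_zero] at h
  exact h

theorem condExp_innov_genSigma (hX : IsRCBAR μ aₙ bₙ ε X a b c d) (h1 : H1 μ aₙ bₙ ε)
    (i : Fin 2 × Fin 2) {n k : ℕ} (hk : k ∈ gen n) :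
    μ[innov μ aₙ bₙ ε X i k | genSigma X n] =ᵐ[μ] 0 :=
  condExp_eq_of_condExp_eq (hX.genSigma_le_othersSigma hk) (hX.othersSigma_le k)
    (hX.condExp_innov h1 i (one_le_of_mem_gen hk)) measurable_const

/-- The product is quadratic in `X k`, up to a power; its middle coefficient mixes centered
coefficients with independent centered noises and has mean zero. The result depends on `X k` alone,
hence is also the conditional expectation given the generation. -/
theorem condExp_innov_mul_self (hX : IsRCBAR μ aₙ bₙ ε X a b c d) (h1 : H1 μ aₙ bₙ ε)
    (i j : Fin 2 × Fin 2) {n k : ℕ} (hk : k ∈ gen n) :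
    μ[fun ω => innov μ aₙ bₙ ε X i k ω * innov μ aₙ bₙ ε X j k ω | genSigma X n] =ᵐ[μ]
      fun ω => coefCov μ aₙ bₙ i.1 j.1 * X k ω ^ ((1 - i.2 : ℕ) + (1 - j.2 : ℕ) + 2) +
        noiseCov μ ε i.1 j.1 * X k ω ^ ((1 - i.2 : ℕ) + (1 - j.2 : ℕ)) := by
  have hk1 := one_le_of_mem_gen hk
  have hXm : Measurable[genSigma X n] (X k) := measurable_X_genSigma (mem_tree_of_mem_gen hk le_rfl)
  refine condExp_eq_of_condExp_eq (hX.genSigma_le_othersSigma hk) (hX.othersSigma_le k) ?_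
    (((hXm.pow_const _).const_mul _).add ((hXm.pow_const _).const_mul _))
  have mc := fun i => measurable_coefDev_effects (μ := μ) (aₙ := aₙ) (bₙ := bₙ) (ε := ε) i k
  have mn := fun i => measurable_noiseDev_effects (μ := μ) (aₙ := aₙ) (bₙ := bₙ) (ε := ε) i k
  have lc := fun i => hX.memLp_coefDev h1 i hk1
  have ln := fun i => hX.memLp_noiseDev h1 i hk1
  have i1 : Integrable (fun ω => coefDev μ aₙ bₙ i.1 k ω * noiseDev μ ε j.1 k ω) μ :=
    (lc i.1).integrable_mul (ln j.1)
  have i2 : Integrable (fun ω => coefDev μ aₙ bₙ j.1 k ω * noiseDev μ ε i.1 k ω) μ :=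
    (lc j.1).integrable_mul (ln i.1)
  have h := hX.condExp_effects_poly h1 hk1 (q := (1 - i.2 : ℕ) + (1 - j.2 : ℕ))
    ((mc i.1).mul (mc j.1)) (((mc i.1).mul (mn j.1)).add ((mc j.1).mul (mn i.1)))
    ((mn i.1).mul (mn j.1)) ((lc i.1).integrable_mul (lc j.1))
    (i1.add i2) ((ln i.1).integrable_mul (ln j.1)) (by omega)
  simp only [Pi.mul_apply, Pi.add_apply] at h
  rw [hX.integral_coefDev_mul i.1 j.1 hk1, hX.integral_noiseDev_mul i.1 j.1 hk1,
    integral_add i1 i2, hX.integral_coefDev_mul_noiseDev h1 i.1 j.1 hk1,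
    hX.integral_coefDev_mul_noiseDev h1 j.1 i.1 hk1] at h
  simp only [add_zero, zero_mul, zero_add] at h
  refine EventuallyEq.trans (Eq.eventuallyEq ?_) h
  congr 1
  funext ω
  simp only [innov]
  ring

/-- Same orthogonality as for the fluctuations: the larger index is centered given a σ-algebra that
sees the smaller one. -/
theorem condExp_innov_mul_of_ne (hX : IsRCBAR μ aₙ bₙ ε X a b c d) (h1 : H1 μ aₙ bₙ ε)
    (i j : Fin 2 × Fin 2) {n k l : ℕ} (hk : k ∈ gen n) (hl : l ∈ gen n) (hkl : k ≠ l) :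
    μ[fun ω => innov μ aₙ bₙ ε X i k ω * innov μ aₙ bₙ ε X j l ω | genSigma X n] =ᵐ[μ] 0 := by
  wlog h : l < k generalizing i j k l
  · simp_rw [mul_comm (innov μ aₙ bₙ ε X i k _)]
    exact this j i hl hk hkl.symm (by omega)
  exact condExp_mul_eq_zero (hX.genSigma_le_othersSigma hk) (hX.othersSigma_le k)
    (hX.memLp_innov h1 i (one_le_of_mem_gen hk)) (hX.memLp_innov h1 j (one_le_of_mem_gen hl))
    (hX.measurable_innov_othersSigma j (one_le_of_mem_gen hl) h).stronglyMeasurable.aestronglyMeasurable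
    (hX.condExp_innov h1 i (one_le_of_mem_gen hk))

theorem condExp_sum_innov (hX : IsRCBAR μ aₙ bₙ ε X a b c d) (h1 : H1 μ aₙ bₙ ε)
    (i : Fin 2 × Fin 2) (n : ℕ) :
    μ[fun ω => ∑ k ∈ gen n, innov μ aₙ bₙ ε X i k ω | genSigma X n] =ᵐ[μ] 0 := by
  have e : (fun ω => ∑ k ∈ gen n, innov μ aₙ bₙ ε X i k ω) =
      ∑ k ∈ gen n, innov μ aₙ bₙ ε X i k := by
    funext ω; rw [Finset.sum_apply]
  rw [e]
  refine (condExp_finsetSum (fun k hk =>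
    (hX.memLp_innov h1 i (one_le_of_mem_gen hk)).integrable one_le_two) _).trans ?_
  filter_upwards [(Finset.eventually_all _).2 fun k hk => hX.condExp_innov_genSigma h1 i hk]
    with ω hω
  rw [Finset.sum_apply, Finset.sum_congr rfl hω]
  simp

theorem condExp_sum_innov_mul (hX : IsRCBAR μ aₙ bₙ ε X a b c d) (h1 : H1 μ aₙ bₙ ε)
    (i j : Fin 2 × Fin 2) (n : ℕ) :
    μ[fun ω => (∑ k ∈ gen n, innov μ aₙ bₙ ε X i k ω) * ∑ k ∈ gen n, innov μ aₙ bₙ ε X j k ω |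
      genSigma X n] =ᵐ[μ] fun ω => ∑ k ∈ gen n,
        (coefCov μ aₙ bₙ i.1 j.1 * X k ω ^ ((1 - i.2 : ℕ) + (1 - j.2 : ℕ) + 2) +
          noiseCov μ ε i.1 j.1 * X k ω ^ ((1 - i.2 : ℕ) + (1 - j.2 : ℕ))) := by
  have e : (fun ω => (∑ k ∈ gen n, innov μ aₙ bₙ ε X i k ω) *
      ∑ k ∈ gen n, innov μ aₙ bₙ ε X j k ω) = ∑ k ∈ gen n, ∑ l ∈ gen n,
        fun ω => innov μ aₙ bₙ ε X i k ω * innov μ aₙ bₙ ε X j l ω := by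
    funext ω
    simp only [Finset.sum_apply, Finset.sum_mul_sum]
  have hint : ∀ k ∈ gen n, ∀ l ∈ gen n,
      Integrable (fun ω => innov μ aₙ bₙ ε X i k ω * innov μ aₙ bₙ ε X j l ω) μ :=
    fun k hk l hl => (hX.memLp_innov h1 i (one_le_of_mem_gen hk)).integrable_mul
      (hX.memLp_innov h1 j (one_le_of_mem_gen hl))
  rw [e]
  refine (condExp_finsetSum (fun k hk => integrable_finsetSum' _ (hint k hk)) _).trans ?_
  have hin : ∀ k ∈ gen n, μ[∑ l ∈ gen n, fun ω => innov μ aₙ bₙ ε X i k ω *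
      innov μ aₙ bₙ ε X j l ω | genSigma X n] =ᵐ[μ] fun ω =>
        coefCov μ aₙ bₙ i.1 j.1 * X k ω ^ ((1 - i.2 : ℕ) + (1 - j.2 : ℕ) + 2) +
          noiseCov μ ε i.1 j.1 * X k ω ^ ((1 - i.2 : ℕ) + (1 - j.2 : ℕ)) := fun k hk => by
    refine (condExp_finsetSum (hint k hk) _).trans ?_
    have hz : ∀ l ∈ (gen n).erase k, μ[fun ω => innov μ aₙ bₙ ε X i k ω *
        innov μ aₙ bₙ ε X j l ω | genSigma X n] =ᵐ[μ] 0 := fun l hl =>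
      hX.condExp_innov_mul_of_ne h1 i j hk (Finset.mem_of_mem_erase hl)
        (Finset.ne_of_mem_erase hl).symm
    filter_upwards [(Finset.eventually_all _).2 hz, hX.condExp_innov_mul_self h1 i j hk]
      with ω hω hs
    rw [Finset.sum_apply, ← Finset.add_sum_erase _ _ hk, hs, Finset.sum_congr rfl hω]
    simp
  filter_upwards [(Finset.eventually_all _).2 hin] with ω hω
  rw [Finset.sum_apply]
  exact Finset.sum_congr rfl hω

/-- By the case `p = 1` of the daughter moments, the conditional mean of a daughter is affine in `X
k`, with the mean effects as coefficients. -/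
theorem V_daughter_ae_eq (hX : IsRCBAR μ aₙ bₙ ε X a b c d) (h1 : H1 μ aₙ bₙ ε) (i : Fin 2)
    {n k : ℕ} (hk : k ∈ gen n) :
    V μ X (2 * k + i) =ᵐ[μ] fun ω => coefDev μ aₙ bₙ i k ω * X k ω + noiseDev μ ε i k ω := by
  have hk1 := one_le_of_mem_gen hk
  have hXm : Measurable[genSigma X n] (X k) := measurable_X_genSigma (mem_tree_of_mem_gen hk le_rfl)
  have h := condExp_eq_of_condExp_eq (hX.genSigma_le_othersSigma hk) (hX.othersSigma_le k)
    (hX.condExp_daughter_pow h1 i hk1 (p := 1) (by norm_num))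
    ((measurable_momentPoly i 1).comp hXm)
  simp only [pow_one] at h
  filter_upwards [h] with ω hω
  rw [V, log_daughter hk i, hω, hX.daughter_eq i hk1 ω]
  simp only [momentPoly, momentCoef, Finset.sum_range_succ, Finset.sum_range_zero, coefDev,
    noiseDev]
  simp [coefMoment, noiseMoment]
  ring

theorem increment_ae_eq (hX : IsRCBAR μ aₙ bₙ ε X a b c d) (h1 : H1 μ aₙ bₙ ε)
    (i : Fin 2 × Fin 2) (n : ℕ) :
    (fun ω => ∑ k ∈ gen n, ![X k ω, 1] i.2 * V μ X (2 * k + i.1) ω) =ᵐ[μ]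
      fun ω => ∑ k ∈ gen n, innov μ aₙ bₙ ε X i k ω := by
  have hw : ∀ (j : Fin 2) (x : ℝ), ![x, 1] j = x ^ (1 - j : ℕ) := fun j x => by
    fin_cases j <;> simp
  filter_upwards [(Finset.eventually_all _).2 fun k hk => hX.V_daughter_ae_eq h1 i.1 hk]
    with ω hω
  refine Finset.sum_congr rfl fun k hk => ?_
  rw [hω k hk, hw, innov]
  ring

theorem memLp_increment (hX : IsRCBAR μ aₙ bₙ ε X a b c d) (h1 : H1 μ aₙ bₙ ε)
    (i : Fin 2 × Fin 2) (n : ℕ) :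
    MemLp (fun ω => ∑ k ∈ gen n, ![X k ω, 1] i.2 * V μ X (2 * k + i.1) ω) 2 μ :=
  (memLp_congr_ae (hX.increment_ae_eq h1 i n)).2
    (memLp_finsetSum _ fun _ hk => hX.memLp_innov h1 i (one_le_of_mem_gen hk))

theorem memLp_M_apply (hX : IsRCBAR μ aₙ bₙ ε X a b c d) (h1 : H1 μ aₙ bₙ ε) (i : Fin 2 × Fin 2)
    (n : ℕ) : MemLp (fun ω => M μ X n ω i) 2 μ :=
  memLp_finsetSum _ fun j _ => hX.memLp_increment h1 i j

theorem memLp_M (hX : IsRCBAR μ aₙ bₙ ε X a b c d) (h1 : H1 μ aₙ bₙ ε) (n : ℕ) :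
    MemLp (M μ X n) 2 μ :=
  MemLp.of_eval fun i => hX.memLp_M_apply h1 i n

theorem martingale_M (hX : IsRCBAR μ aₙ bₙ ε X a b c d) (h1 : H1 μ aₙ bₙ ε) :
    Martingale (M μ X) (genFiltration X hX.measurable_X) μ := by
  have hint := fun n => (hX.memLp_M h1 n).integrable one_le_two
  refine martingale_nat (fun n => (measurable_M_genSigma n).stronglyMeasurable) hint fun n => ?_
  have hi : ∀ i, ∀ᵐ ω ∂μ, M μ X n ω i = (μ[M μ X (n + 1) | genSigma X n]) ω i := fun i => by
    -- Coordinate projections commute with conditional expectation, which reduces the vector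
    -- martingale property to scalar ones.
    have hc := (ContinuousLinearMap.proj (R := ℝ) (φ := fun _ : Fin 2 × Fin 2 => ℝ)
      i).comp_condExp_comm (m := genSigma X n) (hint (n + 1))
    have hadd : (ContinuousLinearMap.proj (R := ℝ) (φ := fun _ : Fin 2 × Fin 2 => ℝ) i) ∘
        M μ X (n + 1) = (fun ω => M μ X n ω i) +
          fun ω => ∑ k ∈ gen n, ![X k ω, 1] i.2 * V μ X (2 * k + i.1) ω := by
      funext ω
      exact Finset.sum_range_succ _ n
    rw [hadd] at hc
    have hMi : Measurable[genSigma X n] fun ω => M μ X n ω i :=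
      (measurable_pi_apply i).comp (measurable_M_genSigma n)
    have hsum := condExp_add (m := genSigma X n)
      ((hX.memLp_M_apply h1 i n).integrable one_le_two)
      ((hX.memLp_increment h1 i n).integrable one_le_two)
    rw [condExp_of_stronglyMeasurable (hX.genSigma_le n)
      hMi.stronglyMeasurable
      ((hX.memLp_M_apply h1 i n).integrable one_le_two)] at hsum
    filter_upwards [hc, hsum, condExp_congr_ae (m := genSigma X n) (hX.increment_ae_eq h1 i n),
      hX.condExp_sum_innov h1 i n] with ω e1 e2 e3 e4
    refine Eq.trans ?_ e1.symm
    rw [e2, Pi.add_apply, e3, e4, Pi.zero_apply, add_zero]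
  filter_upwards [ae_all_iff.2 hi] with ω hω
  exact funext hω

theorem ae_increasingProcess_eq (hX : IsRCBAR μ aₙ bₙ ε X a b c d) (h1 : H1 μ aₙ bₙ ε)
    (i j : Fin 2 × Fin 2) :
    ∀ᵐ ω ∂μ, ∀ n, increasingProcess μ (genFiltration X hX.measurable_X) (M μ X) n ω i j =
      coefCov μ aₙ bₙ i.1 j.1 * ∑ m ∈ Finset.range n, ∑ k ∈ gen m,
          X k ω ^ ((1 - i.2 : ℕ) + (1 - j.2 : ℕ) + 2) +
        noiseCov μ ε i.1 j.1 * ∑ m ∈ Finset.range n, ∑ k ∈ gen m,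
          X k ω ^ ((1 - i.2 : ℕ) + (1 - j.2 : ℕ)) := by
  have hstep : ∀ m, ∀ᵐ ω ∂μ, (μ[fun ω' => (M μ X (m + 1) ω' i - M μ X m ω' i) *
      (M μ X (m + 1) ω' j - M μ X m ω' j) | genSigma X m]) ω = ∑ k ∈ gen m,
        (coefCov μ aₙ bₙ i.1 j.1 * X k ω ^ ((1 - i.2 : ℕ) + (1 - j.2 : ℕ) + 2) +
          noiseCov μ ε i.1 j.1 * X k ω ^ ((1 - i.2 : ℕ) + (1 - j.2 : ℕ))) := fun m => by
    have hd : ∀ i ω, M μ X (m + 1) ω i - M μ X m ω i =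
        ∑ k ∈ gen m, ![X k ω, 1] i.2 * V μ X (2 * k + i.1) ω := fun i ω => by
      simp only [M, Finset.sum_range_succ, add_sub_cancel_left]
    simp_rw [hd]
    refine (condExp_congr_ae ?_).trans (hX.condExp_sum_innov_mul h1 i j m)
    filter_upwards [hX.increment_ae_eq h1 i m, hX.increment_ae_eq h1 j m] with ω e1 e2
    rw [e1, e2]
  filter_upwards [ae_all_iff.2 hstep] with ω hω n
  simp only [increasingProcess, Matrix.of_apply, Finset.mul_sum, ← Finset.sum_add_distrib]
  exact Finset.sum_congr rfl fun m _ => hω m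

/-- At time `n + 1` the increasing process sums over the generations `0, …, n`, that is over `tree
n`. Each entry combines two tree sums of powers of order at most 4, to which the law of large
numbers applies. -/
theorem ae_tendsto_increasingProcess (hX : IsRCBAR μ aₙ bₙ ε X a b c d) (h1 : H1 μ aₙ bₙ ε)
    (h2 : H2 μ aₙ bₙ ε X σa σb σc σd) (h3 : H3 μ aₙ bₙ ε X a b c d σa σb σc σd ρab ρcd) :
    ∀ᵐ ω ∂μ, Tendsto (fun n : ℕ => ((tree n).card : ℝ)⁻¹ •
      increasingProcess μ (genFiltration X hX.measurable_X) (M μ X) (n + 1) ω)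
      atTop (𝓝 (L μ aₙ bₙ ε σa σb σc σd ρab ρcd)) := by
  have hlim := fun (p : ℕ) (hp : p ≤ 8) =>
    hX.ae_tendsto_tree_average h1 (t := limitMoment μ aₙ bₙ ε) (if_pos rfl)
      (fun p hp0 hp => two_mul_limitMoment h1 hp0 hp) hp
  -- With the exponent convention `1 - i`, the entries of `C` and `D` are limit moments of order `(1
  -- - i) + (1 - j)`, shifted by 2 for `D`; the corner entry 1 of `C` is the moment of order 0.
  have hC : ∀ i j : Fin 2, C μ aₙ bₙ ε i j =
      limitMoment μ aₙ bₙ ε ((1 - i : ℕ) + (1 - j : ℕ)) := fun i j => by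
    fin_cases i <;> fin_cases j <;> rfl
  have hD : ∀ i j : Fin 2, D μ aₙ bₙ ε i j =
      limitMoment μ aₙ bₙ ε ((1 - i : ℕ) + (1 - j : ℕ) + 2) := fun i j => by
    fin_cases i <;> fin_cases j <;> rfl
  have hij : ∀ i j, ∀ᵐ ω ∂μ, Tendsto (fun n : ℕ => (((tree n).card : ℝ)⁻¹ •
      increasingProcess μ (genFiltration X hX.measurable_X) (M μ X) (n + 1) ω) i j)
      atTop (𝓝 (L μ aₙ bₙ ε σa σb σc σd ρab ρcd i j)) := fun i j => by
    filter_upwards [hX.ae_increasingProcess_eq h1 i j,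
      hlim ((1 - i.2 : ℕ) + (1 - j.2 : ℕ) + 2) (by omega),
      hlim ((1 - i.2 : ℕ) + (1 - j.2 : ℕ)) (by omega)] with ω e l1 l2
    have hL : L μ aₙ bₙ ε σa σb σc σd ρab ρcd i j =
        coefCov μ aₙ bₙ i.1 j.1 * limitMoment μ aₙ bₙ ε ((1 - i.2 : ℕ) + (1 - j.2 : ℕ) + 2) +
          noiseCov μ ε i.1 j.1 * limitMoment μ aₙ bₙ ε ((1 - i.2 : ℕ) + (1 - j.2 : ℕ)) := by
      rw [hX.coefCov_eq h2 h3, hX.noiseCov_eq h2 h3, ← hC, ← hD]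
      exact add_comm _ _
    rw [hL]
    refine ((l1.const_mul _).add (l2.const_mul _)).congr fun n => ?_
    rw [Matrix.smul_apply, e (n + 1), smul_eq_mul]
    ring
  filter_upwards [ae_all_iff.2 fun i => ae_all_iff.2 fun j => hij i j] with ω hω
  exact tendsto_pi_nhds.2 fun i => tendsto_pi_nhds.2 fun j => hω i j

end IsRCBAR

end Model

end RCBAR

theorem mainTheorem5 {Ω : Type*} [mΩ : MeasurableSpace Ω] (μ : Measure Ω) [IsProbabilityMeasure μ]
    (aₙ bₙ ε X : ℕ → Ω → ℝ) (a b c d σa σb σc σd ρab ρcd : ℝ)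
    (hX : RCBAR.IsRCBAR μ aₙ bₙ ε X a b c d)
    (h1 : RCBAR.H1 μ aₙ bₙ ε)
    (h2 : RCBAR.H2 μ aₙ bₙ ε X σa σb σc σd)
    (h3 : RCBAR.H3 μ aₙ bₙ ε X a b c d σa σb σc σd ρab ρcd) :
    (Martingale (RCBAR.M μ X) (RCBAR.genFiltration X hX.measurable_X) μ ∧
      ∀ n, MemLp (RCBAR.M μ X n) 2 μ) ∧
    (∀ᵐ ω ∂μ, Tendsto
      (fun n : ℕ => ((RCBAR.tree n).card : ℝ)⁻¹ •
        RCBAR.increasingProcess μ (RCBAR.genFiltration X hX.measurable_X) (RCBAR.M μ X) (n + 1) ω)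
      atTop (𝓝 (RCBAR.L μ aₙ bₙ ε σa σb σc σd ρab ρcd))) ∧
    (RCBAR.L μ aₙ bₙ ε σa σb σc σd ρab ρcd).PosDef := by
  exact ⟨⟨hX.martingale_M h1, hX.memLp_M h1⟩, hX.ae_tendsto_increasingProcess h1 h2 h3,
    hX.posDef_L h1 h2 h3⟩
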